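/- Let $\mathcal K$ be the space of non-empty compact subsets (grains) of $\mathbb R^d$ with the Hausdorff metric and its Borel $\sigma$-algebra, and write $c(K)$ for the center of gravity of $K\in\mathcal K$ (for grains of Lebesgue measure zero, which have no center of gravity in this sense, let $c(K)$ be the center of gravity of the closed parallel set $\{x:\operatorname{dist}(x,K)\le 1\}$; this choice does not affect the intensities and $h$-intensities below). A particle process is a random locally finite set of grains (only finitely many grains lie in any bounded subset of $\mathcal K$); it is stationary if its law is invariant under translating all grains by a common vector $x\in\mathbb R^d$, for every $x$, and a pair of particle processes is jointly stationary if its joint law is invariant in the same sense. The intensity of a stationary particle process $\Psi$ is $\gamma(\Psi)=\mathbb E\sum_{K\in\Psi}\mathbf 1\{c(K)\in[0,1]^d\}$. If it is non-zero and finite, the typical grain distribution $\mathbb Q_\Psi$ is the probability measure on $\mathcal K$ that is concentrated on $\{K: c(K)=0\}$ and satisfies the Campbell formula $$\mathbb E\sum_{K\in\Psi}f(K)=\gamma(\Psi)\int_{\mathbb R^d}\int_{\mathcal K}f(K+x)\,\mathbb Q_\Psi(\mathrm dK)\,\mathrm dx$$ for all measurable $f:\mathcal K\to[0,\infty)$;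 that is, $\mathbb Q_\Psi(A)=\gamma(\Psi)^{-1}\,\mathbb E\sum_{K\in\Psi}\mathbf 1\{c(K)\in[0,1]^d\}\mathbf 1\{K-c(K)\in A\}$. For a measurable, translation invariant $h:\mathcal K\to[0,\infty)$, the $h$-intensity of $\Psi$ is $\gamma_h(\Psi)=\gamma(\Psi)\int h\,\mathrm d\mathbb Q_\Psi$ (and $0$ if $\gamma(\Psi)=0$). Let $\Phi$ be a stationary particle process on a probability space $(\Omega_0,\mathcal F_0,\mathbb P_0)$ with intensity $\gamma(\Phi)\in(0,\infty)$. A stationary hard-core thinning of $\Phi$ is a particle process $\Psi$ on some probability space $(\Omega,\mathcal F,\mathbb P)$ for which there is a measurable map $S:\Omega\to\Omega_0$ such that $\mathbb P_0$ is the image of $\mathbb P$ under $S$, $\Psi\subset\Phi\circ S$ in every realization, the pair $(\Psi,\Phi\circ S)$ is jointly stationary, and $\mathbb P$-almost surely any two distinct grains of $\Psi$ have disjoint interiors. Let $\gamma_{h,\max}$ be the supremum of $\gamma_h(\Psi)$ over all stationary hard-core thinnings $\Psi$ of $\Phi$. **Theorem.** Let $h:\mathcal K\to[0,\infty)$ be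 measurable and translation invariant. Assume that $\gamma_h(\Phi)<\infty$ and that the set of discontinuity points of $h$ is a null set of the typical grain distribution $\mathbb Q_\Phi$ of $\Phi$. Then there is a stationary hard-core thinning $\Psi$ of $\Phi$ with $\gamma_h(\Psi)=\gamma_{h,\max}$. -/

import Mathlib

open MeasureTheory Set TopologicalSpace
open scoped ENNReal NNReal

universe u

namespace HardCore

/-- The space of grains: nonempty compact subsets of `ℝ^d`, with the Hausdorff metric. -/
abbrev Grain (d : ℕ) : Type := NonemptyCompacts (EuclideanSpace ℝ (Fin d))

/-- Grains carry the Borel `σ`-algebra of the Hausdorff metric. -/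
instance instMeasurableSpaceGrain (d : ℕ) : MeasurableSpace (Grain d) := borel _

instance instBorelSpaceGrain (d : ℕ) : BorelSpace (Grain d) := ⟨rfl⟩

variable {d : ℕ}

/-- The translate `K + x`. -/
def translate (x : EuclideanSpace ℝ (Fin d)) (K : Grain d) : Grain d :=
  K.map (fun y => y + x) (by fun_prop)

theorem coe_translate (x : EuclideanSpace ℝ (Fin d)) (K : Grain d) :
    (translate x K : Set (EuclideanSpace ℝ (Fin d))) = (fun y => y + x) '' K := rfl

theorem translate_isometry (x : EuclideanSpace ℝ (Fin d)) :
    Isometry (translate (d := d) x) := by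
  intro K L
  change Metric.hausdorffEDist _ _ = Metric.hausdorffEDist _ _
  rw [coe_translate, coe_translate]
  exact Metric.hausdorffEDist_image (isometry_add_right x)

/-- The barycentre of a set with respect to Lebesgue measure. -/
noncomputable def barycentre (A : Set (EuclideanSpace ℝ (Fin d))) : EuclideanSpace ℝ (Fin d) :=
  ⨍ y in A, y

open Classical in
/-- The centre of gravity of a grain. A grain of volume zero has no centre of gravity with respect
to Lebesgue measure; its centre is taken to be the centre of gravity of its parallel set at
distance one. -/
noncomputable def centre (K : Grain d) : EuclideanSpace ℝ (Fin d) :=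
  if volume (K : Set (EuclideanSpace ℝ (Fin d))) = 0 then
    barycentre (Metric.cthickening 1 (K : Set (EuclideanSpace ℝ (Fin d))))
  else barycentre (K : Set (EuclideanSpace ℝ (Fin d)))

/-- The unit cube `[0,1]^d`. -/
def unitCube (d : ℕ) : Set (EuclideanSpace ℝ (Fin d)) := {x | ∀ i, x i ∈ Icc (0 : ℝ) 1}

/-- Locally finite sets of grains: only finitely many grains in each bounded (equivalently, in each
compact) part of the space of grains. -/
def Config (d : ℕ) : Type :=
  {φ : Set (Grain d) // ∀ B : Set (Grain d), Bornology.IsBounded B → (φ ∩ B).Finite}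

namespace Config

/-- The set of grains of a configuration. -/
def grains (φ : Config d) : Set (Grain d) := φ.1

/-- The counting measure of a configuration. -/
noncomputable def toMeasure (φ : Config d) : Measure (Grain d) :=
  Measure.sum fun K : φ.grains => Measure.dirac (K : Grain d)

/-- The `σ`-algebra on configurations is generated by the counting maps `φ ↦ #(φ ∩ B)` for Borel
sets `B` of grains. -/
noncomputable instance instMeasurableSpace : MeasurableSpace (Config d) :=
  MeasurableSpace.comap toMeasure inferInstance

/-- The translate `φ + x = {K + x : K ∈ φ}`. -/
def shift (x : EuclideanSpace ℝ (Fin d)) (φ : Config d) : Config d :=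
  ⟨translate x '' φ.grains, fun B hB => by
    rw [← image_inter_preimage]
    exact (φ.2 _ ((translate_isometry x).antilipschitz.isBounded_preimage hB)).image _⟩

/-- The hard-core condition: distinct grains have disjoint interiors. -/
def IsHardCore (φ : Config d) : Prop :=
  ∀ K ∈ φ.grains, ∀ L ∈ φ.grains, K ≠ L →
    Disjoint (interior (K : Set (EuclideanSpace ℝ (Fin d))))
      (interior (L : Set (EuclideanSpace ℝ (Fin d))))

end Config

/-- A stationary particle process on a probability space. -/
structure IsStationaryParticleProcess {Ω : Type*} [MeasurableSpace Ω] (P : Measure Ω)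
    (Φ : Ω → Config d) : Prop where
  measurable : Measurable Φ
  stationary : ∀ x, P.map (fun ω => (Φ ω).shift x) = P.map Φ

/-- The intensity `γ = 𝔼 ∑_{K ∈ Ψ} 1{c(K) ∈ [0,1]^d}`. -/
noncomputable def intensity {Ω : Type*} [MeasurableSpace Ω] (P : Measure Ω)
    (Ψ : Ω → Config d) : ℝ≥0∞ :=
  ∫⁻ ω, ∑' K : (Ψ ω).grains, {L : Grain d | centre L ∈ unitCube d}.indicator 1 (K : Grain d) ∂P

/-- The intensity measure `B ↦ 𝔼 #(Ψ ∩ B)` on the space of grains. -/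
noncomputable def intensityMeasure {Ω : Type*} [MeasurableSpace Ω] (P : Measure Ω)
    (Ψ : Ω → Config d) : Measure (Grain d) :=
  P.bind fun ω => (Ψ ω).toMeasure

/-- The typical grain distribution
`ℚ(A) = γ⁻¹ 𝔼 ∑_{K ∈ Ψ} 1{c(K) ∈ [0,1]^d} 1{K - c(K) ∈ A}`. (If `γ = 0` this is the zero measure.)
See `typicalGrain_univ`, `typicalGrain_centre` and `campbell` for the properties that characterize
it. -/
noncomputable def typicalGrain {Ω : Type*} [MeasurableSpace Ω] (P : Measure Ω)
    (Ψ : Ω → Config d) : Measure (Grain d) :=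
  (intensity P Ψ)⁻¹ • ((intensityMeasure P Ψ).restrict {K | centre K ∈ unitCube d}).map
    fun K => translate (-centre K) K

/-- The `h`-intensity `γ_h(Ψ) = γ ∫ h dℚ`. -/
noncomputable def hIntensity {Ω : Type*} [MeasurableSpace Ω] (P : Measure Ω)
    (Ψ : Ω → Config d) (h : Grain d → ℝ≥0) : ℝ≥0∞ :=
  intensity P Ψ * ∫⁻ K, h K ∂(typicalGrain P Ψ)

/-- `Ψ`, defined on `(Ω, P)`, is a stationary hard-core thinning of the particle process `Φ`
defined on `(Ω₀, P₀)`, by means of the map `S : Ω → Ω₀`. -/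
structure IsHardCoreThinning {Ω₀ Ω : Type*} [MeasurableSpace Ω₀] [MeasurableSpace Ω]
    (P₀ : Measure Ω₀) (Φ : Ω₀ → Config d) (P : Measure Ω) (S : Ω → Ω₀)
    (Ψ : Ω → Config d) : Prop where
  isProbabilityMeasure : IsProbabilityMeasure P
  measurable : Measurable Ψ
  measurePreserving : MeasurePreserving S P P₀
  subset : ∀ ω, (Ψ ω).grains ⊆ (Φ (S ω)).grains
  stationary : ∀ x, P.map (fun ω => ((Ψ ω).shift x, (Φ (S ω)).shift x)) =
    P.map fun ω => (Ψ ω, Φ (S ω))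
  hardCore : ∀ᵐ ω ∂P, (Ψ ω).IsHardCore

/-- The maximum `h`-intensity: the supremum of `γ_h(Ψ)` over all stationary hard-core thinnings
`Ψ` of `Φ`, on arbitrary probability spaces. -/
noncomputable def maxHIntensity {Ω₀ : Type u} [MeasurableSpace Ω₀] (P₀ : Measure Ω₀)
    (Φ : Ω₀ → Config d) (h : Grain d → ℝ≥0) : ℝ≥0∞ :=
  sSup {v | ∃ (Ω : Type u) (_ : MeasurableSpace Ω) (P : Measure Ω) (S : Ω → Ω₀)
    (Ψ : Ω → Config d), IsHardCoreThinning P₀ Φ P S Ψ ∧ v = hIntensity P Ψ h}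

/- ### The definitions above are proper: measurability, and the Campbell formula -/

theorem continuous_infDist' :
    Continuous fun p : Grain d × EuclideanSpace ℝ (Fin d) =>
      Metric.infDist p.2 (p.1 : Set (EuclideanSpace ℝ (Fin d))) := by
  have h : Continuous fun p : EuclideanSpace ℝ (Fin d) × Grain d =>
      Metric.infDist p.1 (p.2 : Set (EuclideanSpace ℝ (Fin d))) :=
    Metric.uniformContinuous_infDist_Hausdorff_dist.continuous
  have h2 : Continuous fun p : Grain d × EuclideanSpace ℝ (Fin d) => (p.2, p.1) := by fun_prop
  have h3 := h.comp h2
  exact h3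

theorem isClosed_mem :
    IsClosed {p : Grain d × EuclideanSpace ℝ (Fin d) | p.2 ∈ (p.1 : Set _)} := by
  have hc : Continuous fun p : Grain d × EuclideanSpace ℝ (Fin d) =>
      Metric.infDist p.2 (p.1 : Set _) :=
    continuous_infDist'
  have : {p : Grain d × EuclideanSpace ℝ (Fin d) | p.2 ∈ (p.1 : Set _)} =
      {p | Metric.infDist p.2 (p.1 : Set _) = 0} := by
    ext p
    exact p.1.isCompact.isClosed.mem_iff_infDist_zero p.1.nonempty
  rw [this]
  exact isClosed_singleton.preimage hc

theorem isClosed_mem_cthickening :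
    IsClosed {p : Grain d × EuclideanSpace ℝ (Fin d) |
      p.2 ∈ Metric.cthickening 1 (p.1 : Set (EuclideanSpace ℝ (Fin d)))} := by
  have hc : Continuous fun p : Grain d × EuclideanSpace ℝ (Fin d) =>
      Metric.infDist p.2 (p.1 : Set _) :=
    continuous_infDist'
  have : {p : Grain d × EuclideanSpace ℝ (Fin d) |
      p.2 ∈ Metric.cthickening 1 (p.1 : Set (EuclideanSpace ℝ (Fin d)))} =
      {p | Metric.infDist p.2 (p.1 : Set _) ≤ 1} := by
    ext p
    simp only [Metric.mem_cthickening_iff, mem_ofPred_eq, Metric.infDist]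
    rw [ENNReal.le_ofReal_iff_toReal_le (Metric.infEDist_ne_top p.1.nonempty) zero_le_one]
  rw [this]
  exact isClosed_Iic.preimage hc

theorem measurable_barycentre {A : Grain d → Set (EuclideanSpace ℝ (Fin d))}
    (hA : MeasurableSet {p : Grain d × EuclideanSpace ℝ (Fin d) | p.2 ∈ A p.1}) :
    Measurable fun K => barycentre (A K) := by
  have hm : ∀ K, MeasurableSet (A K) := fun K => measurable_prodMk_left hA
  simp only [barycentre, setAverage_eq]
  refine Measurable.smul (M := ℝ) (X := EuclideanSpace ℝ (Fin d)) ?_ ?_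
  · exact (measurable_measure_prodMk_left (ν := volume) hA).ennreal_toReal.inv
  · have h1 : StronglyMeasurable (Function.uncurry
        fun (K : Grain d) (y : EuclideanSpace ℝ (Fin d)) => (A K).indicator (fun y => y) y) := by
      have : Function.uncurry
        (fun (K : Grain d) (y : EuclideanSpace ℝ (Fin d)) => (A K).indicator (fun y => y) y) =
          {p : Grain d × EuclideanSpace ℝ (Fin d) | p.2 ∈ A p.1}.indicator fun p => p.2 := by
        ext1 p
        simp [Function.uncurry, indicator]
      rw [this]
      exact (measurable_snd.indicator hA).stronglyMeasurable
    have h2 := (h1.integral_prod_right (ν := volume)).measurable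
    simpa only [integral_indicator (hm _)] using h2

theorem measurable_centre : Measurable (centre (d := d)) := by
  classical
  unfold centre
  refine Measurable.ite ?_ (measurable_barycentre isClosed_mem_cthickening.measurableSet)
    (measurable_barycentre isClosed_mem.measurableSet)
  exact measurable_measure_prodMk_left (ν := volume) isClosed_mem.measurableSet
    (measurableSet_singleton 0)

theorem barycentre_add {A : Set (EuclideanSpace ℝ (Fin d))} (hA : IsCompact A)
    (h0 : volume A ≠ 0) (x : EuclideanSpace ℝ (Fin d)) :
    barycentre ((fun y => y + x) '' A) = barycentre A + x := by
  have hmp : MeasurePreserving (fun y => y + x) (volume : Measure (EuclideanSpace ℝ (Fin d)))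
    volume := measurePreserving_add_right _ x
  have hf : volume A ≠ ∞ := hA.measure_lt_top.ne
  have hI : IntegrableOn (fun y : EuclideanSpace ℝ (Fin d) => y) A :=
    continuous_id.continuousOn.integrableOn_compact hA
  simp only [barycentre, setAverage_eq]
  rw [hmp.setIntegral_image_emb (measurableEmbedding_addRight x),
    integral_add hI (integrableOn_const hf), setIntegral_const, smul_add, smul_smul]
  have hv : volume.real ((fun y => y + x) '' A) = volume.real A := by
    simp [measureReal_def]
  rw [hv, inv_mul_cancel₀, one_smul]
  simp [measureReal_def, ENNReal.toReal_eq_zero_iff, h0, hf]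

theorem centre_translate (x : EuclideanSpace ℝ (Fin d)) (K : Grain d) :
    centre (translate x K) = centre K + x := by
  have hv : volume (translate x K : Set (EuclideanSpace ℝ (Fin d))) =
      volume (K : Set (EuclideanSpace ℝ (Fin d))) := by
    simp [coe_translate]
  unfold centre
  rw [hv]
  split_ifs with h
  · have : Metric.cthickening 1 (translate x K : Set (EuclideanSpace ℝ (Fin d))) =
        (fun y => y + x) '' Metric.cthickening 1 (K : Set (EuclideanSpace ℝ (Fin d))) := by
      ext y
      rw [coe_translate]
      simp only [image_add_right, mem_preimage, Metric.mem_cthickening_iff]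
      have := Metric.infEDist_image (isometry_add_right x) (x := y + -x) (t := (K : Set _))
      simp at this
      rw [← this]
    rw [this]
    refine barycentre_add K.isCompact.cthickening ?_ x
    obtain ⟨z, hz⟩ := K.nonempty
    refine ((Metric.measure_closedBall_pos volume z one_pos).trans_le (measure_mono ?_)).ne'
    exact Metric.closedBall_subset_cthickening hz 1
  · rw [coe_translate]
    exact barycentre_add K.isCompact h x

theorem continuous_translate :
    Continuous fun p : EuclideanSpace ℝ (Fin d) × Grain d => translate p.1 p.2 := by
  refine (LipschitzWith.of_dist_le_mul (K := 2) fun p q => ?_).continuous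
  have h1 : dist (translate p.1 p.2) (translate q.1 p.2) ≤ dist p.1 q.1 := by
    rw [Metric.NonemptyCompacts.dist_eq]
    refine Metric.hausdorffDist_le_of_mem_dist dist_nonneg ?_ ?_
    · rintro _ ⟨y, hy, rfl⟩
      exact ⟨y + q.1, ⟨y, hy, rfl⟩, by simp⟩
    · rintro _ ⟨y, hy, rfl⟩
      exact ⟨y + p.1, ⟨y, hy, rfl⟩, by simp [dist_comm]⟩
  have h2 : dist (translate q.1 p.2) (translate q.1 q.2) = dist p.2 q.2 :=
    (translate_isometry q.1).dist_eq _ _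
  calc dist (translate p.1 p.2) (translate q.1 q.2)
      ≤ dist p.1 q.1 + dist p.2 q.2 := by
        rw [← h2]; exact (dist_triangle _ _ _).trans (by gcongr)
    _ ≤ dist p q + dist p q := by
        gcongr
        · exact le_max_left _ _
        · exact le_max_right _ _
    _ = (2 : ℝ≥0) * dist p q := by push_cast; ring

theorem measurable_centring :
    Measurable fun K : Grain d => translate (-centre K) K :=
  continuous_translate.measurable.comp (measurable_centre.neg.prodMk measurable_id)

theorem measurableSet_unitCube : MeasurableSet (unitCube d) := by
  have : unitCube d = ⋂ i, (fun x : EuclideanSpace ℝ (Fin d) => x i) ⁻¹' Icc (0 : ℝ) 1 := by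
    ext x; simp [unitCube]
  rw [this]
  exact MeasurableSet.iInter fun i => measurableSet_Icc.preimage (by fun_prop)

theorem volume_unitCube : volume (unitCube d) = 1 := by
  have h := EuclideanSpace.volume_preserving_symm_measurableEquiv_toLp (Fin d)
  have h2 : unitCube d = (MeasurableEquiv.toLp 2 (Fin d → ℝ)).symm ⁻¹'
      (Set.pi univ fun _ => Icc (0 : ℝ) 1) := by
    ext x; simp [unitCube, Pi.le_def, forall_and]
  rw [h2, h.measure_preimage_equiv, volume_pi_pi]
  simp

theorem lintegral_toMeasure (φ : Config d) {f : Grain d → ℝ≥0∞} (hf : Measurable f) :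
    ∫⁻ K, f K ∂φ.toMeasure = ∑' K : φ.grains, f K := by
  simp [Config.toMeasure, lintegral_sum_measure, lintegral_dirac' _ hf]

theorem measurable_toMeasure : Measurable (Config.toMeasure (d := d)) := comap_measurable _

theorem toMeasure_shift (x : EuclideanSpace ℝ (Fin d)) (φ : Config d) :
    (φ.shift x).toMeasure = φ.toMeasure.map (translate x) := by
  ext B hB
  have hm : Measurable (translate (d := d) x) := (translate_isometry x).continuous.measurable
  rw [Measure.map_apply hm hB, ← lintegral_indicator_one hB,
    ← lintegral_indicator_one (hm hB), lintegral_toMeasure _ (measurable_one.indicator hB),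
    lintegral_toMeasure _ (measurable_one.indicator (hm hB))]
  exact tsum_image (g := translate x) (s := φ.grains)
    (B.indicator (1 : Grain d → ℝ≥0∞)) (translate_isometry x).injective.injOn

theorem measurable_shift (x : EuclideanSpace ℝ (Fin d)) :
    Measurable (Config.shift (d := d) x) := by
  refine measurable_comap_iff.2 ?_
  have : (Config.toMeasure ∘ Config.shift (d := d) x) =
      fun φ => φ.toMeasure.map (translate x) := by
    ext1 φ; exact toMeasure_shift x φ
  rw [this]
  exact (Measure.measurable_map _ (translate_isometry x).continuous.measurable).comp
    measurable_toMeasure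

section Campbell

variable {Ω : Type*} [MeasurableSpace Ω] {P : Measure Ω} {Ψ : Ω → Config d}

theorem lintegral_intensityMeasure (hΨ : Measurable Ψ) {f : Grain d → ℝ≥0∞} (hf : Measurable f) :
    ∫⁻ K, f K ∂(intensityMeasure P Ψ) = ∫⁻ ω, ∑' K : (Ψ ω).grains, f K ∂P := by
  have hm : Measurable fun ω => (Ψ ω).toMeasure := measurable_toMeasure.comp hΨ
  rw [intensityMeasure, Measure.lintegral_bind hm.aemeasurable hf.aemeasurable]
  simp only [lintegral_toMeasure _ hf]

theorem measurableSet_centre_mem : MeasurableSet {K : Grain d | centre K ∈ unitCube d} :=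
  measurable_centre measurableSet_unitCube

theorem intensity_eq (hΨ : Measurable Ψ) :
    intensity P Ψ = intensityMeasure P Ψ {K | centre K ∈ unitCube d} := by
  rw [← lintegral_indicator_one measurableSet_centre_mem, lintegral_intensityMeasure hΨ
    (measurable_one.indicator measurableSet_centre_mem), intensity]

/-- The typical grain distribution is a probability measure. -/
theorem typicalGrain_univ (hΨ : Measurable Ψ) (h0 : intensity P Ψ ≠ 0) (h1 : intensity P Ψ ≠ ∞) :
    typicalGrain P Ψ univ = 1 := by
  rw [typicalGrain, Measure.smul_apply, Measure.map_apply measurable_centring MeasurableSet.univ,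
    preimage_univ, Measure.restrict_apply_univ, ← intensity_eq hΨ, smul_eq_mul,
    ENNReal.inv_mul_cancel h0 h1]

/-- The typical grain distribution is concentrated on grains centred at the origin. -/
theorem typicalGrain_centre : typicalGrain P Ψ {K | centre K ≠ 0} = 0 := by
  have hm : MeasurableSet {K : Grain d | centre K ≠ 0} :=
    (measurable_centre (measurableSet_singleton 0)).compl
  rw [typicalGrain, Measure.smul_apply, Measure.map_apply measurable_centring hm]
  have : (fun K : Grain d => translate (-centre K) K) ⁻¹' {K | centre K ≠ 0} = ∅ := by
    ext K; simp [centre_translate]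
  rw [this]; simp

theorem map_intensityMeasure (hΨ : IsStationaryParticleProcess P Ψ)
    (x : EuclideanSpace ℝ (Fin d)) :
    (intensityMeasure P Ψ).map (translate x) = intensityMeasure P Ψ := by
  have hm : Measurable (translate (d := d) x) := (translate_isometry x).continuous.measurable
  have he : ∀ B : Set (Grain d), MeasurableSet B →
      Measurable fun φ : Config d => φ.toMeasure B := fun B hB =>
    (Measure.measurable_coe hB).comp measurable_toMeasure
  have hs : Measurable fun ω => (Ψ ω).shift x := (measurable_shift x).comp hΨ.measurable
  have ht : Measurable fun ω => (Ψ ω).toMeasure := measurable_toMeasure.comp hΨ.measurable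
  have key : ∀ B : Set (Grain d), MeasurableSet B →
      intensityMeasure P Ψ B = ∫⁻ φ : Config d, φ.toMeasure B ∂(P.map Ψ) := fun B hB => by
    rw [lintegral_map (he B hB) hΨ.measurable, intensityMeasure,
      Measure.bind_apply hB ht.aemeasurable]
  ext B hB
  rw [Measure.map_apply hm hB, key B hB, key _ (hm hB),
    lintegral_map (he _ (hm hB)) hΨ.measurable, ← hΨ.stationary x, lintegral_map (he B hB) hs]
  refine lintegral_congr fun ω => ?_
  rw [toMeasure_shift, Measure.map_apply hm hB]

theorem sigmaFinite_intensityMeasure (hΨ : IsStationaryParticleProcess P Ψ)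
    (h1 : intensity P Ψ ≠ ∞) : SigmaFinite (intensityMeasure P Ψ) := by
  refine Measure.sigmaFinite_of_countable (S := range fun z : Fin d → ℤ =>
    translate (WithLp.toLp 2 fun i => -(z i : ℝ)) ⁻¹' {K : Grain d | centre K ∈ unitCube d})
    (countable_range _) ?_ ?_
  · rintro _ ⟨z, rfl⟩
    dsimp only
    rw [← Measure.map_apply (translate_isometry _).continuous.measurable
      measurableSet_centre_mem, map_intensityMeasure hΨ, ← intensity_eq hΨ.measurable]
    exact h1.lt_top
  · refine eq_univ_of_forall fun K => ?_
    refine mem_sUnion.2 ⟨_, ⟨fun i => ⌊centre K i⌋, rfl⟩, ?_⟩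
    simp only [mem_preimage, mem_ofPred_eq, centre_translate, unitCube, mem_Icc]
    intro i
    have h2 := Int.floor_le (centre K i)
    have h3 := Int.lt_floor_add_one (centre K i)
    simp only [PiLp.add_apply]
    constructor <;> linarith

/-- The Campbell formula. -/
theorem campbell (hΨ : IsStationaryParticleProcess P Ψ) (h0 : intensity P Ψ ≠ 0)
    (h1 : intensity P Ψ ≠ ∞) {f : Grain d → ℝ≥0∞} (hf : Measurable f) :
    ∫⁻ ω, ∑' K : (Ψ ω).grains, f K ∂P =
      intensity P Ψ * ∫⁻ x : EuclideanSpace ℝ (Fin d),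
        ∫⁻ K, f (translate x K) ∂(typicalGrain P Ψ) := by
  have := sigmaFinite_intensityMeasure hΨ h1
  set Λ := intensityMeasure P Ψ with hΛ
  set C : Set (Grain d) := {K | centre K ∈ unitCube d} with hC
  have hCm : MeasurableSet C := measurableSet_centre_mem
  have ht : ∀ x, Measurable (translate (d := d) x) := fun x =>
    (translate_isometry x).continuous.measurable
  have hft : Measurable fun p : EuclideanSpace ℝ (Fin d) × Grain d => f (translate p.1 p.2) :=
    hf.comp continuous_translate.measurable
  have htt : ∀ (x y : EuclideanSpace ℝ (Fin d)) (K : Grain d),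
      translate x (translate y K) = translate (y + x) K := fun x y K => by
    ext z
    simp [coe_translate, neg_add_rev, add_assoc]
  have e1 : ∀ x, ∫⁻ K, f (translate x K) ∂(typicalGrain P Ψ) =
      (intensity P Ψ)⁻¹ * ∫⁻ K in C, f (translate (-centre K + x) K) ∂Λ := fun x => by
    have hfx : Measurable fun K => f (translate x K) := hf.comp (ht x)
    rw [typicalGrain, lintegral_smul_measure, lintegral_map hfx measurable_centring, smul_eq_mul]
    simp only [htt, hΛ, hC]
  have hm2 : Measurable fun p : EuclideanSpace ℝ (Fin d) × Grain d =>
      f (translate (-centre p.2 + p.1) p.2) :=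
    hft.comp (((measurable_centre.comp measurable_snd).neg.add measurable_fst).prodMk
      measurable_snd)
  simp only [e1]
  rw [lintegral_const_mul' _ _ (ENNReal.inv_ne_top.2 h0), ← mul_assoc,
    ENNReal.mul_inv_cancel h0 h1, one_mul, ← lintegral_intensityMeasure hΨ.measurable hf,
    lintegral_lintegral_swap hm2.aemeasurable]
  have e2 : ∀ K : Grain d, ∫⁻ x, f (translate (-centre K + x) K) = ∫⁻ x, f (translate x K) :=
    fun K => lintegral_add_left_eq_self (fun x => f (translate x K)) (-centre K)
  simp only [e2]
  rw [lintegral_lintegral_swap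
    (f := fun (K : Grain d) (x : EuclideanSpace ℝ (Fin d)) => f (translate x K))
    (hft.comp measurable_swap).aemeasurable]
  have e3 : ∀ x, ∫⁻ K in C, f (translate x K) ∂Λ =
      ∫⁻ K, (unitCube d).indicator 1 (centre K - x) * f K ∂Λ := fun x => by
    have hmx : Measurable fun K : Grain d =>
        (unitCube d).indicator (1 : EuclideanSpace ℝ (Fin d) → ℝ≥0∞) (centre K - x) * f K :=
      ((measurable_one.indicator measurableSet_unitCube).comp
        (measurable_centre.sub_const x)).mul hf
    conv_rhs => rw [hΛ, ← map_intensityMeasure hΨ x, lintegral_map hmx (ht x)]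
    rw [← lintegral_indicator hCm]
    refine lintegral_congr fun K => ?_
    by_cases h : centre K ∈ unitCube d <;> simp [centre_translate, hC, h]
  simp only [e3]
  have hm3 : Measurable fun p : EuclideanSpace ℝ (Fin d) × Grain d =>
      (unitCube d).indicator (1 : EuclideanSpace ℝ (Fin d) → ℝ≥0∞) (centre p.2 - p.1) * f p.2 :=
    ((measurable_one.indicator measurableSet_unitCube).comp
      ((measurable_centre.comp measurable_snd).sub measurable_fst)).mul (hf.comp measurable_snd)
  rw [lintegral_lintegral_swap hm3.aemeasurable]
  refine lintegral_congr fun K => ?_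
  have hm4 : Measurable fun x : EuclideanSpace ℝ (Fin d) =>
      (unitCube d).indicator (1 : EuclideanSpace ℝ (Fin d) → ℝ≥0∞) (centre K - x) :=
    (measurable_one.indicator measurableSet_unitCube).comp (measurable_const.sub measurable_id)
  rw [lintegral_mul_const _ hm4,
    lintegral_sub_left_eq_self (fun x => (unitCube d).indicator (1 : EuclideanSpace ℝ (Fin d) → ℝ≥0∞) x) (centre K),
    lintegral_indicator_one measurableSet_unitCube, volume_unitCube, one_mul]

end Campbell

end HardCore

namespace HardCore

open Filter Topology ProbabilityTheory

/-! ### Setwise limits of dominated measures. -/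

section SetwiseLimits

variable {X κ : Type*} [MeasurableSpace X]

/-! The theorem is a compactness argument: hard-core thinnings, described by joint laws, form a
compact set on which the `h`-intensity is continuous.

Number the grains of each configuration measurably (`index`). A part of `φ` then becomes a binary
sequence of marks, and a thinning becomes a law on `Config d × (ℕ → Bool)` whose first marginal is
the law `μ` of `Φ`. The topology tests such laws on products of an arbitrary measurable set with a
cylinder. Every slice of such a law over a cylinder is dominated by `μ`, so its setwise limits along
an ultrafilter are again measures (`exists_setwise_limit`). The limits are consistent in the
cylinder, and their densities with respect to `μ` are conditional probabilities, so an independent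
uniform variable realizes them (`exists_cylinderTendsto`).

Domination by `μ` also carries all constraints to the limit. A violation of the hard-core condition
is a countable union of product sets. Shifting permutes the indices of the grains in a way that
depends only on the configuration, so the preimage of a cylinder product under the shift is a
countable disjoint union of such products (`shiftMarked_preimage`), and stationarity survives
(`IsHardCoreMarking.of_cylinderTendsto`).

The `h`-intensity is a series over indices of slice integrals, dominated by the corresponding series
for `Φ`, whose sum `γ_h(Φ)` is finite. It therefore converges along the ultrafilter
(`CylinderTendsto.lintegral_tsum`), and the limit of a maximizing sequence attains the supremum. -/

theorem tendsto_tsum_ennreal_of_dominated {J : Type*} {l : Filter κ} {f : κ → J → ℝ≥0∞}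
    {g b : J → ℝ≥0∞} (hb : ∑' j, b j ≠ ∞) (hfb : ∀ k j, f k j ≤ b j)
    (hfg : ∀ j, Tendsto (fun k => f k j) l (𝓝 (g j))) :
    Tendsto (fun k => ∑' j, f k j) l (𝓝 (∑' j, g j)) := by
  rcases l.eq_or_neBot with rfl | hl
  · simp
  have hbj : ∀ j, b j ≠ ∞ := ENNReal.ne_top_of_tsum_ne_top hb
  have hgb : ∀ j, g j ≤ b j := fun j => le_of_tendsto' (hfg j) fun k => hfb k j
  have hfj : ∀ k j, f k j ≠ ∞ := fun k j => ne_top_of_le_ne_top (hbj j) (hfb k j)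
  have hgj : ∀ j, g j ≠ ∞ := fun j => ne_top_of_le_ne_top (hbj j) (hgb j)
  have hfs : ∀ k, ∑' j, f k j ≠ ∞ := fun k =>
    ne_top_of_le_ne_top hb (ENNReal.tsum_le_tsum (hfb k))
  have hgs : ∑' j, g j ≠ ∞ := ne_top_of_le_ne_top hb (ENNReal.tsum_le_tsum hgb)
  rw [← ENNReal.tendsto_toReal_iff hfs hgs]
  simp only [ENNReal.tsum_toReal_eq hgj, ENNReal.tsum_toReal_eq (hfj _)]
  refine tendsto_tsum_of_dominated_convergence (bound := fun j => (b j).toReal)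
    (ENNReal.summable_toReal hb) (fun j => (ENNReal.tendsto_toReal (hgj j)).comp (hfg j))
    (Eventually.of_forall fun k j => ?_)
  rw [Real.norm_of_nonneg ENNReal.toReal_nonneg]
  exact ENNReal.toReal_mono (hbj j) (hfb k j)

/-- Compactness of `ℝ≥0∞` provides the limit on each set separately. Countable additivity survives
because the finite measure `μ` dominates the series over disjoint pieces uniformly in `k`. -/
theorem exists_setwise_limit (μ : Measure X) [IsFiniteMeasure μ] (l : Ultrafilter κ)
    (m : κ → Measure X) (hm : ∀ k, m k ≤ μ) :
    ∃ ν : Measure X, ∀ A, MeasurableSet A →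
      Tendsto (fun k => m k A) l (𝓝 (ν A)) := by
  have hlim : ∀ A, Tendsto (fun k => m k A) l (𝓝 (l.map fun k => m k A).lim) := fun A =>
    (l.map fun k => m k A).le_nhds_lim
  refine ⟨Measure.ofMeasurable (fun A _ => (l.map fun k => m k A).lim) ?_ ?_, fun A hA => ?_⟩
  · exact tendsto_nhds_unique (hlim ∅) (by simp)
  · intro f hf hd
    refine tendsto_nhds_unique (hlim _) ?_
    simp only [measure_iUnion hd hf]
    refine tendsto_tsum_ennreal_of_dominated (b := fun i => μ (f i)) ?_ (fun k i => hm k _)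
      fun i => hlim _
    rw [← measure_iUnion hd hf]
    exact measure_ne_top _ _
  · rw [Measure.ofMeasurable_apply A hA]
    exact hlim A

/-- Writing `g` as a series of simple functions reduces the claim to single sets. The series is
dominated by the one for `μ`, whose sum is the finite integral of `g`. -/
theorem tendsto_lintegral_of_setwise {μ ν : Measure X} {l : Filter κ} {m : κ → Measure X}
    (hm : ∀ k, m k ≤ μ) (h : ∀ A, MeasurableSet A → Tendsto (fun k => m k A) l (𝓝 (ν A)))
    {g : X → ℝ≥0∞} (hg : Measurable g) (hfin : ∫⁻ x, g x ∂μ ≠ ∞) :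
    Tendsto (fun k => ∫⁻ x, g x ∂(m k)) l (𝓝 (∫⁻ x, g x ∂ν)) := by
  have key : ∀ ν' : Measure X, ∫⁻ x, g x ∂ν' =
      ∑' n, ∫⁻ x, (SimpleFunc.eapproxDiff g n x : ℝ≥0∞) ∂ν' := fun ν' => by
    rw [← lintegral_tsum fun n => (SimpleFunc.measurable _).coe_nnreal_ennreal.aemeasurable]
    simp only [SimpleFunc.tsum_eapproxDiff g hg]
  simp only [key]
  rw [key] at hfin
  refine tendsto_tsum_ennreal_of_dominated hfin
    (fun k n => lintegral_mono' (hm k) le_rfl) fun n => ?_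
  have hs : ∀ ν' : Measure X, ∫⁻ x, (SimpleFunc.eapproxDiff g n x : ℝ≥0∞) ∂ν' =
      ∑ c ∈ (SimpleFunc.eapproxDiff g n).range,
        (c : ℝ≥0∞) * ν' (SimpleFunc.eapproxDiff g n ⁻¹' {c}) := fun ν' => by
    have := SimpleFunc.lintegral_eq_lintegral
      ((SimpleFunc.eapproxDiff g n).map ((↑) : ℝ≥0 → ℝ≥0∞)) ν'
    rw [SimpleFunc.map_lintegral] at this
    simpa using this
  simp only [hs]
  exact tendsto_finsetSum _ fun c _ => ENNReal.Tendsto.const_mul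
    (h _ (SimpleFunc.measurableSet_fiber _ _)) (Or.inr ENNReal.coe_ne_top)

end SetwiseLimits

/-! ### Realizing consistent families of measures by random binary sequences. -/

section Words

/-- The first `n` terms of a binary sequence, most recent first. -/
def prefixWord (η : ℕ → Bool) : ℕ → List Bool
  | 0 => []
  | n + 1 => η n :: prefixWord η n

theorem length_prefixWord (η : ℕ → Bool) (n : ℕ) : (prefixWord η n).length = n := by
  induction n with
  | zero => rfl
  | succ n ih => simp [prefixWord, ih]

theorem eq_of_prefixWord_eq {η η' : ℕ → Bool} {n : ℕ} (h : prefixWord η n = prefixWord η' n)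
    {i : ℕ} (hi : i < n) : η i = η' i := by
  induction n with
  | zero => omega
  | succ n ih =>
    simp only [prefixWord, List.cons.injEq] at h
    rcases Nat.lt_succ_iff_lt_or_eq.1 hi with h' | rfl
    · exact ih h.2 h'
    · exact h.1

theorem measurableSet_prefixWord_eq (n : ℕ) (w : List Bool) :
    MeasurableSet {η : ℕ → Bool | prefixWord η n = w} := by
  induction n generalizing w with
  | zero => simp [prefixWord]
  | succ n ih =>
    rcases w with _ | ⟨b, w⟩
    · simp [prefixWord]
    · simp only [prefixWord, List.cons.injEq]
      exact (measurable_pi_apply n (measurableSet_singleton b)).inter (ih w)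

/-- The left end of the subinterval of `[0, 1)` belonging to a word, when the interval of a word is
divided in the proportion of the weights of its two extensions. -/
def lowerEnd (p : List Bool → ℝ) : List Bool → ℝ
  | [] => 0
  | false :: w => lowerEnd p w
  | true :: w => lowerEnd p w + p (false :: w)

open Classical in
/-- The word of length `n` whose subinterval contains `u`. -/
noncomputable def wordAt (p : List Bool → ℝ) (u : ℝ) : ℕ → List Bool
  | 0 => []
  | n + 1 => decide (lowerEnd p (wordAt p u n) + p (false :: wordAt p u n) ≤ u) :: wordAt p u n

open Classical in
/-- The binary sequence whose prefixes are the words `wordAt p u n`. -/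
noncomputable def bitAt (p : List Bool → ℝ) (u : ℝ) (n : ℕ) : Bool :=
  decide (lowerEnd p (wordAt p u n) + p (false :: wordAt p u n) ≤ u)

/-- Both definitions put the newest bit at the head, so that an extension of a word is a `cons` and
inductions on words follow the refinement of intervals. -/
theorem prefixWord_bitAt (p : List Bool → ℝ) (u : ℝ) (n : ℕ) :
    prefixWord (bitAt p u) n = wordAt p u n := by
  induction n with
  | zero => rfl
  | succ n ih => simp [prefixWord, wordAt, ih, bitAt]

/-- The interval of `w` has length `p w` and is cut at `lowerEnd p w + p (false :: w)`; by
additivity the two pieces are the intervals of the two extensions. The inclusion in `[0, 1)` ensures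
that restricting Lebesgue measure loses none of this length. -/
theorem wordAt_length_eq_iff {p : List Bool → ℝ} (h0 : p [] = 1) (hp : ∀ w, 0 ≤ p w)
    (hadd : ∀ w, p w = p (false :: w) + p (true :: w)) (w : List Bool) :
    Ico (lowerEnd p w) (lowerEnd p w + p w) ⊆ Ico 0 1 ∧ ∀ u ∈ Ico (0 : ℝ) 1,
      (wordAt p u w.length = w ↔ u ∈ Ico (lowerEnd p w) (lowerEnd p w + p w)) := by
  induction w with
  | nil => simp [lowerEnd, wordAt, h0]
  | cons b w ih =>
    have h1 := hp (false :: w)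
    have h2 := hp (true :: w)
    have h3 := hadd w
    cases b
    · refine ⟨Subset.trans (Ico_subset_Ico ?_ ?_) ih.1, fun u hu => ?_⟩
      · simp [lowerEnd]
      · simp only [lowerEnd]; linarith
      · simp only [List.length_cons, wordAt, List.cons.injEq, decide_eq_false_iff_not, lowerEnd]
        constructor
        · rintro ⟨ha, hb⟩
          have hc := (ih.2 u hu).1 hb
          rw [hb] at ha
          exact ⟨hc.1, not_le.1 ha⟩
        · intro hc
          have hb := (ih.2 u hu).2 ⟨hc.1, by linarith [hc.2]⟩
          rw [hb]
          exact ⟨not_le.2 hc.2, rfl⟩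
    · refine ⟨Subset.trans (Ico_subset_Ico ?_ ?_) ih.1, fun u hu => ?_⟩
      · simp only [lowerEnd]; linarith
      · simp only [lowerEnd]; linarith
      · simp only [List.length_cons, wordAt, List.cons.injEq, decide_eq_true_eq, lowerEnd]
        constructor
        · rintro ⟨ha, hb⟩
          have hc := (ih.2 u hu).1 hb
          rw [hb] at ha
          exact ⟨ha, by linarith [hc.2]⟩
        · intro hc
          have hb := (ih.2 u hu).2 ⟨by linarith [hc.1], by linarith [hc.2]⟩
          rw [hb]
          exact ⟨hc.1, rfl⟩

theorem volume_restrict_wordAt_eq {p : List Bool → ℝ} (h0 : p [] = 1) (hp : ∀ w, 0 ≤ p w)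
    (hadd : ∀ w, p w = p (false :: w) + p (true :: w)) (w : List Bool) :
    volume.restrict (Ico (0 : ℝ) 1) {u | wordAt p u w.length = w} = ENNReal.ofReal (p w) := by
  obtain ⟨h1, h2⟩ := wordAt_length_eq_iff h0 hp hadd w
  have : volume.restrict (Ico (0 : ℝ) 1) {u | wordAt p u w.length = w} =
      volume.restrict (Ico (0 : ℝ) 1) (Ico (lowerEnd p w) (lowerEnd p w + p w)) := by
    refine measure_congr ?_
    filter_upwards [ae_restrict_mem measurableSet_Ico] with u hu
    exact propext (h2 u hu)
  rw [this, Measure.restrict_apply measurableSet_Ico, inter_eq_self_of_subset_left h1,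
    Real.volume_Ico]
  simp

variable {X : Type*} [MeasurableSpace X]

theorem measurable_lowerEnd {p : X → List Bool → ℝ} (hp : ∀ w, Measurable fun x => p x w)
    (w : List Bool) : Measurable fun x => lowerEnd (p x) w := by
  induction w with
  | nil => exact measurable_const
  | cons b w ih =>
    cases b
    · exact ih
    · exact ih.add (hp _)

theorem measurableSet_wordAt_eq {p : X → List Bool → ℝ} (hp : ∀ w, Measurable fun x => p x w)
    (n : ℕ) (w : List Bool) : MeasurableSet {z : X × ℝ | wordAt (p z.1) z.2 n = w} := by
  induction n generalizing w with
  | zero => simp [wordAt]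
  | succ n ih =>
    rcases w with _ | ⟨b, w⟩
    · simp [wordAt]
    · have : {z : X × ℝ | wordAt (p z.1) z.2 (n + 1) = b :: w} =
          {z | (lowerEnd (p z.1) w + p z.1 (false :: w) ≤ z.2) ↔ b = true} ∩
            {z | wordAt (p z.1) z.2 n = w} := by
        ext z
        simp only [wordAt, List.cons.injEq, mem_ofPred_eq, mem_inter_iff]
        constructor
        · rintro ⟨h1, h2⟩
          rw [h2] at h1
          exact ⟨by rw [← h1]; simp, h2⟩
        · rintro ⟨h1, h2⟩
          rw [h2]
          exact ⟨by cases b <;> simpa using h1, rfl⟩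
      rw [this]
      refine MeasurableSet.inter ?_ (ih w)
      have hm : MeasurableSet {z : X × ℝ | lowerEnd (p z.1) w + p z.1 (false :: w) ≤ z.2} :=
        measurableSet_le (((measurable_lowerEnd hp w).comp measurable_fst).add
          ((hp _).comp measurable_fst)) measurable_snd
      cases b
      · simp only [Bool.false_eq_true, iff_false]
        exact hm.compl
      · simpa using hm

theorem measurable_bitAt {p : X → List Bool → ℝ} (hp : ∀ w, Measurable fun x => p x w) :
    Measurable fun z : X × ℝ => bitAt (p z.1) z.2 := by
  refine measurable_pi_lambda _ fun n => measurable_to_bool ?_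
  have : (fun z : X × ℝ => bitAt (p z.1) z.2 n) ⁻¹' {true} =
      ⋃ w, {z | wordAt (p z.1) z.2 (n + 1) = true :: w} := by
    ext z
    simp [bitAt, wordAt]
  rw [this]
  exact MeasurableSet.iUnion fun w => measurableSet_wordAt_eq hp _ _

/-- A consistent family of measures indexed by finite words is realized by a binary sequence
depending measurably on the base point and an independent uniform variable. -/
theorem exists_bits_of_consistent (μ : Measure X) [IsProbabilityMeasure μ]
    (m : List Bool → Measure X) (h0 : m [] = μ)
    (hadd : ∀ w, m w = m (false :: w) + m (true :: w)) :
    ∃ ξ : X × ℝ → ℕ → Bool, Measurable ξ ∧ ∀ w A, MeasurableSet A →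
      (μ.prod (volume.restrict (Ico (0 : ℝ) 1))).map (fun z => (z.1, ξ z))
        (A ×ˢ {η | prefixWord η w.length = w}) = m w A := by
  have hle : ∀ w, m w ≤ μ := fun w => by
    induction w with
    | nil => exact h0.le
    | cons b w ih =>
      refine le_trans ?_ ih
      rw [hadd w]
      cases b
      · exact Measure.le_add_right le_rfl
      · exact Measure.le_add_left le_rfl
  have hfin : ∀ w, IsFiniteMeasure (m w) := fun w => isFiniteMeasure_of_le μ (hle w)
  have hac : ∀ w, m w ≪ μ := fun w => (Measure.absolutelyContinuous_of_le (hle w))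
  -- The density is the conditional probability, given `x`, that the sequence starts with `w`.
  set p : X → List Bool → ℝ := fun x w => ((m w).rnDeriv μ x).toReal with hp
  have hpm : ∀ w, Measurable fun x => p x w := fun w =>
    (Measure.measurable_rnDeriv _ _).ennreal_toReal
  have hξ := measurable_bitAt hpm
  refine ⟨fun z => bitAt (p z.1) z.2, hξ, fun w A hA => ?_⟩
  -- There are only countably many words, so the almost sure relations hold for all of them
  -- simultaneously off one null set.
  have hgood : ∀ᵐ x ∂μ, p x [] = 1 ∧ (∀ w, p x w = p x (false :: w) + p x (true :: w)) ∧
      ∀ w, (m w).rnDeriv μ x < ∞ := by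
    refine Eventually.and ?_ (Eventually.and ?_ ?_)
    · rw [hp]
      simp only [h0]
      filter_upwards [Measure.rnDeriv_self μ] with x hx
      simp [hx]
    · refine ae_all_iff.2 fun w => ?_
      filter_upwards [Measure.rnDeriv_add (m (false :: w)) (m (true :: w)) μ,
        Measure.rnDeriv_lt_top (m (false :: w)) μ, Measure.rnDeriv_lt_top (m (true :: w)) μ]
        with x hx h1 h2
      simp only [hp]
      rw [hadd w, hx, Pi.add_apply, ENNReal.toReal_add h1.ne h2.ne]
    · exact ae_all_iff.2 fun w => Measure.rnDeriv_lt_top _ _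
  rw [Measure.map_apply (measurable_fst.prodMk hξ)
    (hA.prod (measurableSet_prefixWord_eq _ _))]
  have hpre : (fun z : X × ℝ => (z.1, bitAt (p z.1) z.2)) ⁻¹'
      (A ×ˢ {η | prefixWord η w.length = w}) =
      Prod.fst ⁻¹' A ∩ {z | wordAt (p z.1) z.2 w.length = w} := by
    ext z
    simp [prefixWord_bitAt]
  rw [hpre, Measure.prod_apply ((measurable_fst hA).inter (measurableSet_wordAt_eq hpm _ _))]
  calc _ = ∫⁻ x, A.indicator (fun x => (m w).rnDeriv μ x) x ∂μ := by
        refine lintegral_congr_ae ?_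
        filter_upwards [hgood] with x hx
        by_cases hxA : x ∈ A
        · have := volume_restrict_wordAt_eq hx.1 (fun w => ENNReal.toReal_nonneg) hx.2.1 w
          have he : Prod.mk x ⁻¹' (Prod.fst ⁻¹' A ∩ {z : X × ℝ | wordAt (p z.1) z.2 w.length = w}) =
              {u | wordAt (p x) u w.length = w} := by
            ext u
            simp [hxA]
          rw [he, this, indicator_of_mem hxA, ENNReal.ofReal_toReal (hx.2.2 w).ne]
        · have he : Prod.mk x ⁻¹' (Prod.fst ⁻¹' A ∩ {z : X × ℝ | wordAt (p z.1) z.2 w.length = w}) =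
              ∅ := by
            ext u
            simp [hxA]
          rw [he, indicator_of_notMem hxA, measure_empty]
    _ = m w A := by
        rw [lintegral_indicator hA, ← withDensity_apply _ hA,
          Measure.withDensity_rnDeriv_eq _ _ (hac w)]

end Words

/-! ### Compactness of laws with a prescribed first marginal. -/

section Compactness

variable {X κ : Type*} [MeasurableSpace X]

/-- The binary sequences that are `true` on `F`. -/
def trueOn (F : Finset ℕ) : Set (ℕ → Bool) := {η | ∀ i ∈ F, η i = true}

theorem measurableSet_trueOn (F : Finset ℕ) : MeasurableSet (trueOn F) := by
  have : trueOn F = ⋂ i ∈ F, (fun η => η i) ⁻¹' {true} := by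
    ext; simp [trueOn]
  rw [this]
  exact MeasurableSet.biInter F.countable_toSet fun i _ =>
    measurable_pi_apply i (measurableSet_singleton true)

/-- Convergence on products of measurable sets and of cylinders. -/
def CylinderTendsto (l : Filter κ) (ρ : κ → Measure (X × (ℕ → Bool)))
    (ρ' : Measure (X × (ℕ → Bool))) : Prop :=
  ∀ A, MeasurableSet A → ∀ F, Tendsto (fun k => ρ k (A ×ˢ trueOn F)) l (𝓝 (ρ' (A ×ˢ trueOn F)))

/-- Compactness of the measures on `X × (ℕ → Bool)` with a given first marginal. Test functions are
only required to be measurable in `X`; this is why the `h`-intensity of thinnings is continuous in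
this sense for every measurable `h`, whether or not `h` has discontinuities. -/
theorem exists_cylinderTendsto (μ : Measure X) [IsProbabilityMeasure μ] (l : Ultrafilter κ)
    (ρ : κ → Measure (X × (ℕ → Bool))) (hρ : ∀ k, (ρ k).map Prod.fst = μ) :
    ∃ ξ : X × ℝ → ℕ → Bool, Measurable ξ ∧ CylinderTendsto l ρ
      ((μ.prod (volume.restrict (Ico (0 : ℝ) 1))).map fun z => (z.1, ξ z)) := by
  have hslice : ∀ k w, ((ρ k).restrict {z | prefixWord z.2 w.length = w}).map Prod.fst ≤ μ :=
    fun k w => (Measure.map_mono Measure.restrict_le_self measurable_fst).trans (hρ k).le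
  choose m hm using fun w => exists_setwise_limit μ l
    (fun k => ((ρ k).restrict {z | prefixWord z.2 w.length = w}).map Prod.fst)
    fun k => hslice k w
  have hm' : ∀ w A, MeasurableSet A →
      Tendsto (fun k => ρ k (A ×ˢ {η | prefixWord η w.length = w})) l (𝓝 (m w A)) := by
    intro w A hA
    refine (hm w A hA).congr fun k => ?_
    rw [Measure.map_apply measurable_fst hA, Measure.restrict_apply (measurable_fst hA)]
    rfl
  -- Words of equal length have disjoint cylinders, so a finite set of them contributes additively.
  -- This later turns `trueOn F` into a finite sum of word cylinders.
  have hsum : ∀ (W : Finset (List Bool)) (n : ℕ), (∀ w ∈ W, w.length = n) →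
      ∀ (A : Set X) (ν : Measure (X × (ℕ → Bool))), MeasurableSet A →
      ν (A ×ˢ {η | prefixWord η n ∈ W}) =
        ∑ w ∈ W, ν (A ×ˢ {η | prefixWord η w.length = w}) := by
    intro W n hW A ν hA
    rw [← measure_biUnion_finset]
    · congr 1
      ext z
      simp only [mem_prod, mem_ofPred_eq, mem_iUnion, exists_prop]
      constructor
      · rintro ⟨h1, h2⟩
        exact ⟨_, h2, h1, by rw [length_prefixWord]⟩
      · rintro ⟨w, hw, h1, h2⟩
        rw [hW w hw] at h2
        exact ⟨h1, h2 ▸ hw⟩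
    · intro w hw w' hw' hne
      refine disjoint_left.2 fun z hz hz' => hne ?_
      have h1 := hz.2
      have h2 := hz'.2
      simp only [mem_ofPred_eq] at h1 h2
      rw [hW w hw] at h1
      rw [hW w' hw'] at h2
      exact h1.symm.trans h2
    · exact fun w _ => hA.prod (measurableSet_prefixWord_eq _ _)
  have hnil : m [] = μ := by
    ext A hA
    refine tendsto_nhds_unique (hm' [] A hA) ?_
    refine (tendsto_const_nhds (x := μ A)).congr fun k => ?_
    rw [← hρ k, Measure.map_apply measurable_fst hA]
    congr 1
    ext z
    simp [prefixWord]
  have hcons : ∀ w, m w = m (false :: w) + m (true :: w) := by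
    intro w
    ext A hA
    refine tendsto_nhds_unique (hm' w A hA) ?_
    rw [Measure.add_apply]
    refine ((hm' _ A hA).add (hm' _ A hA)).congr fun k => ?_
    rw [← measure_union]
    · congr 1
      ext z
      simp only [List.length_cons, prefixWord, List.cons.injEq, mem_union, mem_prod, mem_ofPred_eq]
      cases z.2 w.length <;> simp
    · refine disjoint_left.2 fun z hz hz' => ?_
      have h1 := hz.2
      have h2 := hz'.2
      simp only [List.length_cons, prefixWord, List.cons.injEq, mem_ofPred_eq] at h1 h2
      exact Bool.false_ne_true (h1.1.symm.trans h2.1)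
    · exact hA.prod (measurableSet_prefixWord_eq _ _)
  obtain ⟨ξ, hξ, hξm⟩ := exists_bits_of_consistent μ m hnil hcons
  refine ⟨ξ, hξ, fun A hA F => ?_⟩
  -- Every coordinate in `F` is below this length, so the prefix of length `n` decides membership in
  -- `trueOn F`.
  set n := F.sup id + 1
  have hfinite : (((fun η => prefixWord η n) '' trueOn F)).Finite :=
    (List.finite_length_eq Bool n).subset (by rintro _ ⟨η, _, rfl⟩; exact length_prefixWord η n)
  have hF : trueOn F = {η | prefixWord η n ∈ hfinite.toFinset} := by
    ext η
    simp only [Finite.mem_toFinset, mem_ofPred_eq, mem_image]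
    constructor
    · exact fun h => ⟨η, h, rfl⟩
    · rintro ⟨η', h1, h2⟩ i hi
      have hlt : i < n := Nat.lt_succ_of_le (Finset.le_sup (f := id) hi)
      rw [← eq_of_prefixWord_eq h2 hlt]
      exact h1 i hi
  have hlen : ∀ w ∈ hfinite.toFinset, w.length = n := by
    intro w hw
    obtain ⟨η, _, rfl⟩ := hfinite.mem_toFinset.1 hw
    exact length_prefixWord η n
  rw [hF]
  simp only [hsum _ n hlen A _ hA, hξm _ A hA]
  exact tendsto_finsetSum _ fun w _ => hm' w A hA

/-- Each summand is an integral of `g j` against a slice dominated by `μ`, and slices converge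
setwise. Finiteness of the total under `μ` allows interchanging the limit with the sum over `j`. -/
theorem CylinderTendsto.lintegral_tsum {μ : Measure X} {l : Filter κ}
    {ρ : κ → Measure (X × (ℕ → Bool))} {ρ' : Measure (X × (ℕ → Bool))}
    (h : CylinderTendsto l ρ ρ') (hρ : ∀ k, (ρ k).map Prod.fst = μ)
    {J : Type*} [Countable J] {g : J → X → ℝ≥0∞} (hg : ∀ j, Measurable (g j))
    (F : J → Finset ℕ) (hfin : ∑' j, ∫⁻ x, g j x ∂μ ≠ ∞) :
    Tendsto (fun k => ∫⁻ z, ∑' j, (trueOn (F j)).indicator (fun _ => g j z.1) z.2 ∂(ρ k)) l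
      (𝓝 (∫⁻ z, ∑' j, (trueOn (F j)).indicator (fun _ => g j z.1) z.2 ∂ρ')) := by
  have hmeas : ∀ j, Measurable fun z : X × (ℕ → Bool) =>
      (trueOn (F j)).indicator (fun _ => g j z.1) z.2 := fun j =>
    ((hg j).comp measurable_fst).indicator (measurable_snd (measurableSet_trueOn (F j)))
  have hslice : ∀ (ν : Measure (X × (ℕ → Bool))) (j : J),
      ∫⁻ z, (trueOn (F j)).indicator (fun _ => g j z.1) z.2 ∂ν =
      ∫⁻ x, g j x ∂((ν.restrict {z | z.2 ∈ trueOn (F j)}).map Prod.fst) := fun ν j => by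
    rw [lintegral_map (hg j) measurable_fst]
    exact lintegral_indicator (measurable_snd (measurableSet_trueOn (F j))) fun z => g j z.1
  simp only [MeasureTheory.lintegral_tsum fun j => (hmeas j).aemeasurable, hslice]
  have hle : ∀ k j, ((ρ k).restrict {z | z.2 ∈ trueOn (F j)}).map Prod.fst ≤ μ := fun k j =>
    (Measure.map_mono Measure.restrict_le_self measurable_fst).trans (hρ k).le
  refine tendsto_tsum_ennreal_of_dominated hfin (fun k j => lintegral_mono' (hle k j) le_rfl)
    fun j => tendsto_lintegral_of_setwise (hle · j) (fun A hA => ?_) (hg j)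
      (ENNReal.ne_top_of_tsum_ne_top hfin j)
  have he : ∀ ν : Measure (X × (ℕ → Bool)),
      (ν.restrict {z | z.2 ∈ trueOn (F j)}).map Prod.fst A = ν (A ×ˢ trueOn (F j)) := fun ν => by
    rw [Measure.map_apply measurable_fst hA, Measure.restrict_apply (measurable_fst hA)]
    rfl
  simp only [he]
  exact h A hA (F j)

/-- Cylinder convergence implies convergence on countable disjoint unions of products. -/
theorem CylinderTendsto.measure_iUnion {μ : Measure X} [IsFiniteMeasure μ] {l : Filter κ}
    {ρ : κ → Measure (X × (ℕ → Bool))} {ρ' : Measure (X × (ℕ → Bool))}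
    (h : CylinderTendsto l ρ ρ') (hρ : ∀ k, (ρ k).map Prod.fst = μ)
    {J : Type*} [Countable J] {A : J → Set X} (hA : ∀ j, MeasurableSet (A j))
    (hd : Pairwise (Function.onFun Disjoint A)) (F : J → Finset ℕ) :
    Tendsto (fun k => ρ k (⋃ j, A j ×ˢ trueOn (F j))) l
      (𝓝 (ρ' (⋃ j, A j ×ˢ trueOn (F j)))) := by
  have hd' : Pairwise (Function.onFun Disjoint fun j => A j ×ˢ trueOn (F j)) := fun i j hij =>
    Set.disjoint_prod.2 (Or.inl (hd hij))
  have hm : ∀ j, MeasurableSet (A j ×ˢ trueOn (F j)) := fun j =>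
    (hA j).prod (measurableSet_trueOn _)
  simp only [MeasureTheory.measure_iUnion hd' hm]
  refine tendsto_tsum_ennreal_of_dominated (b := fun j => μ (A j)) ?_ (fun k j => ?_)
    fun j => h _ (hA j) _
  · rw [← MeasureTheory.measure_iUnion hd hA]
    exact measure_ne_top _ _
  · rw [← hρ k, Measure.map_apply measurable_fst (hA j)]
    exact measure_mono fun z hz => hz.1

end Compactness

variable {d : ℕ}

/-! ### A measurable numbering of the grains of a configuration. -/

section Enumeration

/-- Grains are sorted into shells according to their integer distance from a fixed grain. -/
noncomputable def shell (K : Grain d) : ℕ := ⌊dist K default⌋₊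

theorem measurable_shell : Measurable (shell (d := d)) :=
  Nat.measurable_floor.comp (continuous_id.dist continuous_const).measurable

theorem isBounded_shell (n : ℕ) : Bornology.IsBounded {K : Grain d | shell K = n} := by
  refine (Metric.isBounded_closedBall (x := (default : Grain d)) (r := n + 1)).subset ?_
  intro K hK
  rw [Metric.mem_closedBall, ← (show shell K = n from hK)]
  exact (Nat.lt_floor_add_one _).le

theorem measurableSet_shell (n : ℕ) : MeasurableSet {K : Grain d | shell K = n} :=
  measurable_shell (measurableSet_singleton n)

theorem toMeasure_lt_top (φ : Config d) {B : Set (Grain d)} (hB : MeasurableSet B)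
    (hb : Bornology.IsBounded B) : φ.toMeasure B < ∞ := by
  rw [← lintegral_indicator_one hB, lintegral_toMeasure _ (measurable_one.indicator hB),
    tsum_subtype φ.grains (B.indicator (1 : Grain d → ℝ≥0∞)), indicator_indicator]
  rw [← tsum_subtype (φ.grains ∩ B) (1 : Grain d → ℝ≥0∞)]
  have := (φ.2 B hb).fintype
  change ∑' K : (φ.1 ∩ B : Set (Grain d)), (1 : ℝ≥0∞) < ∞
  rw [tsum_fintype]
  simp

theorem toMeasure_singleton {φ : Config d} {K : Grain d} (hK : K ∈ φ.grains) :
    1 ≤ φ.toMeasure {K} := by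
  rw [← lintegral_indicator_one (measurableSet_singleton K),
    lintegral_toMeasure _ (measurable_one.indicator (measurableSet_singleton K))]
  refine le_trans ?_ (ENNReal.le_tsum ⟨K, hK⟩)
  simp

/-- The counting measures of configurations, as a kernel. -/
noncomputable def countingKernel (d : ℕ) : Kernel (Config d) (Grain d) :=
  ⟨Config.toMeasure, measurable_toMeasure⟩

theorem countingKernel_apply (φ : Config d) : countingKernel d φ = φ.toMeasure := rfl

/-- Each shell contains finitely many grains, but their number is not bounded uniformly over
configurations. The kernel is therefore split both by shell and by the number of grains in that
shell. S-finiteness gives measurability of sums over grains that depend on parameters. -/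
instance isSFiniteKernel_countingKernel : IsSFiniteKernel (countingKernel d) := by
  classical
  let c : ℕ → Config d → ℕ := fun n φ => ⌊(φ.toMeasure {K | shell K = n}).toReal⌋₊
  have hc : ∀ n m, MeasurableSet {φ | c n φ = m} := fun n m => by
    have : Measurable (c n) := Nat.measurable_floor.comp
      (((Measure.measurable_coe (measurableSet_shell n)).comp measurable_toMeasure).ennreal_toReal)
    exact this (measurableSet_singleton m)
  let κ : ℕ → ℕ → Kernel (Config d) (Grain d) := fun n m =>
    Kernel.piecewise (hc n m) ((countingKernel d).restrict (measurableSet_shell n)) 0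
  have hκ : ∀ n m, IsFiniteKernel (κ n m) := fun n m => by
    refine ⟨⟨m + 1, by finiteness, fun φ => ?_⟩⟩
    rw [Kernel.piecewise_apply]
    split_ifs with h
    · rw [Kernel.restrict_apply, Measure.restrict_apply_univ, countingKernel_apply]
      have hfin := (toMeasure_lt_top φ (measurableSet_shell n) (isBounded_shell n)).ne
      have h' : c n φ = m := h
      rw [← ENNReal.ofReal_toReal hfin, ← h']
      refine (ENNReal.ofReal_le_ofReal (Nat.lt_floor_add_one _).le).trans ?_
      rw [ENNReal.ofReal_add (by positivity) zero_le_one]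
      simp [c]
    · simp
  have hsum : countingKernel d = Kernel.sum fun n => Kernel.sum fun m => κ n m := by
    ext φ B hB
    rw [Kernel.sum_apply' _ _ hB]
    have h1 : ∀ n, Kernel.sum (fun m => κ n m) φ B = φ.toMeasure (B ∩ {K | shell K = n}) := by
      intro n
      rw [Kernel.sum_apply' _ _ hB, tsum_eq_single (c n φ)]
      · rw [Kernel.piecewise_apply, if_pos (show φ ∈ {φ' | c n φ' = c n φ} from rfl),
          Kernel.restrict_apply, Measure.restrict_apply hB, countingKernel_apply]
      · intro m hm
        rw [Kernel.piecewise_apply, if_neg (show φ ∉ {φ | c n φ = m} from hm.symm)]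
        simp
    simp only [h1]
    rw [← MeasureTheory.measure_iUnion, ← inter_iUnion, countingKernel_apply]
    · congr 1
      ext K
      simp
    · exact fun i j hij => disjoint_left.2 fun K hK hK' => hij (hK.2.symm.trans hK'.2)
    · exact fun n => hB.inter (measurableSet_shell n)
  rw [hsum]
  infer_instance

variable {Ω : Type*} [MeasurableSpace Ω] {Ψ : Ω → Config d}

theorem measurable_lintegral_toMeasure (hΨ : Measurable Ψ) {f : Ω → Grain d → ℝ≥0∞}
    (hf : Measurable (Function.uncurry f)) :
    Measurable fun ω => ∫⁻ K, f ω K ∂(Ψ ω).toMeasure :=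
  hf.lintegral_kernel_prod_right (κ := (countingKernel d).comap Ψ hΨ)

/-- Existence of such a grain means that the number of such grains is nonzero, and this number is a
measurable function of `ω`. -/
theorem measurableSet_exists_mem_grains (hΨ : Measurable Ψ) {D : Set (Ω × Grain d)}
    (hD : MeasurableSet D) : MeasurableSet {ω | ∃ K ∈ (Ψ ω).grains, (ω, K) ∈ D} := by
  have hm := measurable_lintegral_toMeasure (f := fun ω K => D.indicator 1 (ω, K)) hΨ
    (measurable_one.indicator hD)
  have : {ω | ∃ K ∈ (Ψ ω).grains, (ω, K) ∈ D} =
      {ω | ∫⁻ K, D.indicator 1 (ω, K) ∂(Ψ ω).toMeasure = 0}ᶜ := by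
    ext ω
    have hmω : Measurable fun K => D.indicator (1 : Ω × Grain d → ℝ≥0∞) (ω, K) :=
      (measurable_one.indicator hD).comp measurable_prodMk_left
    simp only [mem_compl_iff, mem_ofPred_eq]
    rw [lintegral_toMeasure _ hmω, ENNReal.tsum_eq_zero]
    simp
  rw [this]
  exact (hm (measurableSet_singleton 0)).compl

/-- The grains of the shell of `K` which precede `K`. -/
def preceding (K : Grain d) : Set (Grain d) :=
  {L | shell L = shell K ∧ embeddingReal (Grain d) L < embeddingReal (Grain d) K}

/-- The order inside a shell is pulled back from `ℝ` along a measurable embedding, which makes it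
both total and measurable. -/
theorem measurableSet_preceding :
    MeasurableSet {p : Grain d × Grain d | p.2 ∈ preceding p.1} := by
  have he := (measurableEmbedding_embeddingReal (Grain d)).measurable
  exact (measurableSet_eq_fun (measurable_shell.comp measurable_snd)
    (measurable_shell.comp measurable_fst)).inter
    (measurableSet_lt (he.comp measurable_snd) (he.comp measurable_fst))

theorem toMeasure_preceding_lt_top (φ : Config d) (K : Grain d) :
    φ.toMeasure (preceding K) < ∞ :=
  toMeasure_lt_top φ (measurable_prodMk_left measurableSet_preceding)
    ((isBounded_shell (shell K)).subset fun _ h => h.1)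

/-- A numbering of the grains of a configuration. -/
noncomputable def index (φ : Config d) (K : Grain d) : ℕ :=
  Nat.pair (shell K) ⌊(φ.toMeasure (preceding K)).toReal⌋₊

theorem measurable_index : Measurable fun z : Config d × Grain d => index z.1 z.2 := by
  have h1 : Measurable fun z : Config d × Grain d => z.1.toMeasure (preceding z.2) := by
    have := measurable_lintegral_toMeasure (Ψ := fun z : Config d × Grain d => z.1) measurable_fst
      (f := fun z L => {p : Grain d × Grain d | p.2 ∈ preceding p.1}.indicator 1 (z.2, L))
      ((measurable_one.indicator measurableSet_preceding).comp
        ((measurable_snd.comp measurable_fst).prodMk measurable_snd))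
    convert this using 2 with z
    exact (lintegral_indicator_one (measurable_prodMk_left measurableSet_preceding)).symm
  have h2 : Measurable fun p : ℕ × ℕ => Nat.pair p.1 p.2 := measurable_from_prod_countable_right fun _ =>
    measurable_from_nat
  exact h2.comp ((measurable_shell.comp measurable_snd).prodMk
    (Nat.measurable_floor.comp h1.ennreal_toReal))

/-- If `K` in `φ` precedes `L` in the same shell, then `L` is preceded by `K` and by all that
precedes `K`, so its rank is larger by at least one. -/
theorem index_injOn (φ : Config d) : InjOn (index φ) φ.grains := by
  have key : ∀ K ∈ φ.grains, ∀ L, shell K = shell L →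
      embeddingReal (Grain d) K < embeddingReal (Grain d) L → index φ K ≠ index φ L := by
    intro K hK L hs hlt he
    have h1 := (Nat.pair_eq_pair.1 he).2
    have hsub : preceding K ∪ {K} ⊆ preceding L := by
      rintro M (hM | rfl)
      · exact ⟨hM.1.trans hs, hM.2.trans hlt⟩
      · exact ⟨hs, hlt⟩
    have hle : φ.toMeasure (preceding K) + 1 ≤ φ.toMeasure (preceding L) := by
      refine le_trans ?_ (measure_mono hsub)
      rw [measure_union (disjoint_singleton_right.2 fun h => lt_irrefl _ h.2)
        (measurableSet_singleton K)]
      gcongr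
      exact toMeasure_singleton hK
    have h2 := ENNReal.toReal_mono (toMeasure_preceding_lt_top φ L).ne hle
    rw [ENNReal.toReal_add (toMeasure_preceding_lt_top φ K).ne ENNReal.one_ne_top,
      ENNReal.toReal_one] at h2
    have h3 := Nat.floor_mono h2
    rw [Nat.floor_add_one ENNReal.toReal_nonneg, h1] at h3
    omega
  intro K hK L hL he
  have hs := (Nat.pair_eq_pair.1 he).1
  rcases lt_trichotomy (embeddingReal (Grain d) K) (embeddingReal (Grain d) L) with h | h | h
  · exact absurd he (key K hK L hs h)
  · exact (measurableEmbedding_embeddingReal (Grain d)).injective h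
  · exact absurd he.symm (key L hL K hs.symm h)

end Enumeration

/-! ### Encoding parts of a configuration by binary marks. -/

section Thinning

open Classical in
/-- The marks of the grains of `φ` that encode the part `ψ` of `φ`. -/
noncomputable def marks (ψ φ : Config d) (n : ℕ) : Bool :=
  decide (∃ K ∈ ψ.grains, index φ K = n)

/-- The grains of `φ` whose marks are `true`. -/
noncomputable def thin (φ : Config d) (η : ℕ → Bool) : Config d :=
  ⟨{K | K ∈ φ.grains ∧ η (index φ K) = true}, fun B hB =>
    (φ.2 B hB).subset fun _ hK => ⟨hK.1.1, hK.2⟩⟩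

theorem mem_thin {φ : Config d} {η : ℕ → Bool} {K : Grain d} :
    K ∈ (thin φ η).grains ↔ K ∈ φ.grains ∧ η (index φ K) = true := Iff.rfl

theorem mem_shift {φ : Config d} {x : EuclideanSpace ℝ (Fin d)} {K : Grain d} :
    K ∈ (φ.shift x).grains ↔ ∃ L ∈ φ.grains, translate x L = K := Iff.rfl

theorem marks_eq_true {ψ φ : Config d} {n : ℕ} :
    marks ψ φ n = true ↔ ∃ K ∈ ψ.grains, index φ K = n := by
  simp [marks]

/-- Injectivity of the numbering on `φ` ensures that a mark set by a grain of `ψ` selects that grain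
only. -/
theorem thin_marks {ψ φ : Config d} (h : ψ.grains ⊆ φ.grains) : thin φ (marks ψ φ) = ψ := by
  refine Subtype.ext (Set.ext fun K => ?_)
  change K ∈ (thin φ (marks ψ φ)).grains ↔ K ∈ ψ.grains
  rw [mem_thin, marks_eq_true]
  constructor
  · rintro ⟨hK, L, hL, he⟩
    rwa [← index_injOn φ (h hL) hK he]
  · exact fun hK => ⟨h hK, K, hK, rfl⟩

theorem measurable_marks : Measurable fun p : Config d × Config d => marks p.1 p.2 := by
  refine measurable_pi_lambda _ fun n => measurable_to_bool ?_
  have : (fun p : Config d × Config d => marks p.1 p.2 n) ⁻¹' {true} =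
      {p | ∃ K ∈ p.1.grains, (p, K) ∈ {z : (Config d × Config d) × Grain d |
        index z.1.2 z.2 = n}} := by
    ext p
    simp [marks_eq_true]
  rw [this]
  exact measurableSet_exists_mem_grains measurable_fst
    ((measurable_index.comp ((measurable_snd.comp measurable_fst).prodMk measurable_snd))
      (measurableSet_singleton n))

theorem measurableSet_mark_index :
    MeasurableSet {z : (Config d × (ℕ → Bool)) × Grain d | z.1.2 (index z.1.1 z.2) = true} := by
  have h1 : Measurable fun p : ℕ × (ℕ → Bool) => p.2 p.1 :=
    measurable_from_prod_countable_right fun n => measurable_pi_apply n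
  have h2 : Measurable fun z : (Config d × (ℕ → Bool)) × Grain d => z.1.2 (index z.1.1 z.2) :=
    h1.comp ((measurable_index.comp ((measurable_fst.comp measurable_fst).prodMk
      measurable_snd)).prodMk (measurable_snd.comp measurable_fst))
  exact h2 (measurableSet_singleton true)

theorem lintegral_thin (φ : Config d) (η : ℕ → Bool) {f : Grain d → ℝ≥0∞} (hf : Measurable f) :
    ∫⁻ K, f K ∂(thin φ η).toMeasure =
      ∫⁻ K, {K | η (index φ K) = true}.indicator f K ∂φ.toMeasure := by
  have hm : MeasurableSet {K | η (index φ K) = true} :=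
    measurable_prodMk_left (x := (φ, η)) measurableSet_mark_index
  rw [lintegral_toMeasure _ hf, lintegral_toMeasure _ (hf.indicator hm), tsum_subtype _ f,
    tsum_subtype φ.grains ({K | η (index φ K) = true}.indicator f), indicator_indicator]
  rfl

theorem measurable_thin : Measurable fun z : Config d × (ℕ → Bool) => thin z.1 z.2 := by
  refine measurable_comap_iff.2 (Measure.measurable_of_measurable_coe _ fun B hB => ?_)
  have h1 : (fun z : Config d × (ℕ → Bool) => (thin z.1 z.2).toMeasure B) = fun z =>
      ∫⁻ K, {w : (Config d × (ℕ → Bool)) × Grain d | w.1.2 (index w.1.1 w.2) = true}.indicator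
        (fun w => B.indicator 1 w.2) (z, K) ∂z.1.toMeasure := by
    ext z
    rw [← lintegral_indicator_one hB, lintegral_thin _ _ (measurable_one.indicator hB)]
    rfl
  change Measurable fun z : Config d × (ℕ → Bool) => (thin z.1 z.2).toMeasure B
  rw [h1]
  exact measurable_lintegral_toMeasure measurable_fst
    (((measurable_one.indicator hB).comp measurable_snd).indicator measurableSet_mark_index)

end Thinning

/-! ### Measurability of the hard-core condition. -/

section HardCoreMeasurability

/-- Pairs of distinct grains with overlapping interiors. -/
def overlapping (d : ℕ) : Set (Grain d × Grain d) :=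
  {p | p.1 ≠ p.2 ∧ ¬ Disjoint (interior (p.1 : Set (EuclideanSpace ℝ (Fin d))))
    (interior (p.2 : Set (EuclideanSpace ℝ (Fin d))))}

/-- Two interiors meet exactly when some nonempty set of a countable basis lies in both grains, and
containing a given set is a closed condition on a grain. -/
theorem measurableSet_overlapping : MeasurableSet (overlapping d) := by
  have hsub : ∀ B : Set (EuclideanSpace ℝ (Fin d)),
      MeasurableSet {K : Grain d | B ⊆ (K : Set (EuclideanSpace ℝ (Fin d)))} := fun B => by
    have : {K : Grain d | B ⊆ (K : Set (EuclideanSpace ℝ (Fin d)))} =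
        ⋂ y ∈ B, {K : Grain d | y ∈ (K : Set (EuclideanSpace ℝ (Fin d)))} := by
      ext K
      simp [subset_def]
    rw [this]
    exact (isClosed_biInter fun y _ => isClosed_mem.preimage
      (Continuous.prodMk_left y)).measurableSet
  have : overlapping d = {p | p.1 ≠ p.2} ∩
      ⋃ B ∈ countableBasis (EuclideanSpace ℝ (Fin d)),
        {K : Grain d | B ⊆ (K : Set (EuclideanSpace ℝ (Fin d)))} ×ˢ
          {K : Grain d | B ⊆ (K : Set (EuclideanSpace ℝ (Fin d)))} := by
    ext ⟨K, L⟩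
    simp only [overlapping, mem_ofPred_eq, mem_inter_iff, mem_iUnion, mem_prod, exists_prop,
      and_congr_right_iff]
    intro _
    constructor
    · intro h
      obtain ⟨y, hy⟩ := not_disjoint_iff_nonempty_inter.1 h
      obtain ⟨B, hB, _, hBs⟩ := (isBasis_countableBasis _).exists_subset_of_mem_open hy
        (isOpen_interior.inter isOpen_interior)
      exact ⟨B, hB, fun z hz => interior_subset (hBs hz).1, fun z hz => interior_subset (hBs hz).2⟩
    · rintro ⟨B, hB, hK, hL⟩ hd
      obtain ⟨y, hy⟩ := nonempty_of_mem_countableBasis hB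
      have ho := isOpen_of_mem_countableBasis hB
      exact disjoint_left.1 hd (interior_maximal hK ho hy) (interior_maximal hL ho hy)
  rw [this]
  exact (measurableSet_eq_fun measurable_fst measurable_snd).compl.inter
    (MeasurableSet.biUnion (countable_countableBasis _) fun B _ => (hsub B).prod (hsub B))

theorem isHardCore_iff {φ : Config d} :
    φ.IsHardCore ↔ ¬ ∃ K ∈ φ.grains, ∃ L ∈ φ.grains, (K, L) ∈ overlapping d := by
  simp only [Config.IsHardCore, overlapping, mem_ofPred_eq]
  push Not
  rfl

variable {Ω : Type*} [MeasurableSpace Ω] {Ψ : Ω → Config d}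

theorem measurableSet_exists_pair (hΨ : Measurable Ψ) {D : Set (Ω × Grain d × Grain d)}
    (hD : MeasurableSet D) :
    MeasurableSet {ω | ∃ K ∈ (Ψ ω).grains, ∃ L ∈ (Ψ ω).grains, (ω, K, L) ∈ D} := by
  have h1 : MeasurableSet {z : Ω × Grain d | ∃ L ∈ (Ψ z.1).grains, (z, L) ∈
      {w : (Ω × Grain d) × Grain d | (w.1.1, w.1.2, w.2) ∈ D}} :=
    measurableSet_exists_mem_grains (hΨ.comp measurable_fst) (by
      have : Measurable fun w : (Ω × Grain d) × Grain d => (w.1.1, w.1.2, w.2) := by fun_prop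
      exact this hD)
  exact measurableSet_exists_mem_grains hΨ h1

theorem measurableSet_isHardCore : MeasurableSet {φ : Config d | φ.IsHardCore} := by
  have := (measurableSet_exists_pair (Ψ := fun φ : Config d => φ) measurable_id
    (measurable_snd (measurableSet_overlapping (d := d)))).compl
  convert this using 1
  ext φ
  exact isHardCore_iff

end HardCoreMeasurability

/-! ### The `h`-intensity as a sum over indices. -/

section HIntensity

/-- The weight `h` restricted to the grains centred in the unit cube. -/
noncomputable def cubeWeight (h : Grain d → ℝ≥0) : Grain d → ℝ≥0∞ :=
  {K | centre K ∈ unitCube d}.indicator fun K => h K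

theorem measurable_cubeWeight {h : Grain d → ℝ≥0} (hh : Measurable h) :
    Measurable (cubeWeight h) :=
  hh.coe_nnreal_ennreal.indicator measurableSet_centre_mem

/-- Translation invariance of `h` undoes the centring in the typical grain distribution, and the
normalization cancels. What remains is additive in the grains. -/
theorem hIntensity_eq_lintegral {Ω : Type*} [MeasurableSpace Ω] {P : Measure Ω}
    {Ψ : Ω → Config d} (hΨ : Measurable Ψ) (hfin : intensity P Ψ ≠ ∞) {h : Grain d → ℝ≥0}
    (hh : Measurable h) (hinv : ∀ x K, h (translate x K) = h K) :
    hIntensity P Ψ h = ∫⁻ ω, ∫⁻ K, cubeWeight h K ∂(Ψ ω).toMeasure ∂P := by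
  have hr : ∫⁻ ω, ∫⁻ K, cubeWeight h K ∂(Ψ ω).toMeasure ∂P =
      ∫⁻ K in {K | centre K ∈ unitCube d}, h K ∂(intensityMeasure P Ψ) := by
    rw [← lintegral_indicator measurableSet_centre_mem]
    simp only [lintegral_toMeasure _ (measurable_cubeWeight hh)]
    exact (lintegral_intensityMeasure hΨ (measurable_cubeWeight hh)).symm
  rw [hr, hIntensity, typicalGrain, lintegral_smul_measure,
    lintegral_map hh.coe_nnreal_ennreal measurable_centring, smul_eq_mul]
  simp only [hinv]
  -- The factors `γ` and `γ⁻¹` do not cancel for `γ = 0`; in that case the cube carries no intensity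
  -- measure and both sides vanish.
  rcases eq_or_ne (intensity P Ψ) 0 with h0 | h0
  · rw [h0, zero_mul, setLIntegral_measure_zero _ _ (by rw [← intensity_eq hΨ, h0])]
  · rw [← mul_assoc, ENNReal.mul_inv_cancel h0 hfin, one_mul]

/-- The contribution of the grain with a given index to an additive functional. -/
noncomputable def indexedWeight (w : Grain d → ℝ≥0∞) (n : ℕ) (φ : Config d) : ℝ≥0∞ :=
  ∫⁻ K, {K | index φ K = n}.indicator w K ∂φ.toMeasure

theorem measurableSet_index_eq (n : ℕ) :
    MeasurableSet {z : Config d × Grain d | index z.1 z.2 = n} :=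
  measurable_index (measurableSet_singleton n)

theorem measurable_indexedWeight {w : Grain d → ℝ≥0∞} (hw : Measurable w) (n : ℕ) :
    Measurable (indexedWeight w n) :=
  measurable_lintegral_toMeasure (Ψ := fun φ : Config d => φ) measurable_id
    (f := fun φ => {K | index φ K = n}.indicator w)
    ((hw.comp measurable_snd).indicator (measurableSet_index_eq n))

theorem measurable_indicator_index {w : Grain d → ℝ≥0∞} (hw : Measurable w) (n : ℕ)
    (φ : Config d) : Measurable ({K | index φ K = n}.indicator w) :=
  hw.indicator (measurable_prodMk_left (measurableSet_index_eq n))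

theorem tsum_indexedWeight {w : Grain d → ℝ≥0∞} (hw : Measurable w) (φ : Config d) :
    ∑' n, indexedWeight w n φ = ∫⁻ K, w K ∂φ.toMeasure := by
  simp only [indexedWeight]
  rw [← lintegral_tsum fun n => (measurable_indicator_index hw n φ).aemeasurable]
  refine lintegral_congr fun K => ?_
  rw [tsum_eq_single (index φ K) fun n hn => indicator_of_notMem (fun h => hn h.symm) _]
  simp

/-- This separates the variables: each term is a function of `φ` times the indicator of a cylinder
in `η`, as required by `CylinderTendsto.lintegral_tsum`. -/
theorem lintegral_thin_eq_tsum {w : Grain d → ℝ≥0∞} (hw : Measurable w) (φ : Config d)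
    (η : ℕ → Bool) : ∫⁻ K, w K ∂(thin φ η).toMeasure =
      ∑' n, (trueOn {n}).indicator (fun _ => indexedWeight w n φ) η := by
  have h1 : ∀ n, (trueOn {n}).indicator (fun _ => indexedWeight w n φ) η =
      ∫⁻ K, (trueOn {n}).indicator (fun _ => {K | index φ K = n}.indicator w K) η
        ∂φ.toMeasure := fun n => by
    by_cases hn : η ∈ trueOn {n} <;> simp [hn, indexedWeight]
  simp only [h1]
  rw [lintegral_thin _ _ hw, ← lintegral_tsum]
  · refine lintegral_congr fun K => ?_
    rw [tsum_eq_single (index φ K)]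
    · by_cases hn : η (index φ K) = true <;> simp [hn, trueOn]
    · intro n hn
      have : K ∉ {K | index φ K = n} := fun h => hn h.symm
      by_cases hη : η ∈ trueOn {n} <;> simp [hη, this]
  · intro n
    by_cases hn : η ∈ trueOn {n}
    · simpa [hn] using (measurable_indicator_index hw n φ).aemeasurable
    · simp [hn]

end HIntensity

/-! ### Laws of marked configurations and their limits. -/

section Markings

/-- The joint law of a particle process and of marks of its grains that select a stationary
hard-core thinning. -/
structure IsHardCoreMarking (μ : Measure (Config d)) (ρ : Measure (Config d × (ℕ → Bool))) :
    Prop where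
  map_fst : ρ.map Prod.fst = μ
  stationary : ∀ x, ρ.map (fun z => ((thin z.1 z.2).shift x, z.1.shift x)) =
    ρ.map fun z => (thin z.1 z.2, z.1)
  hardCore : ∀ᵐ z ∂ρ, (thin z.1 z.2).IsHardCore

theorem measurable_shift_thin (x : EuclideanSpace ℝ (Fin d)) :
    Measurable fun z : Config d × (ℕ → Bool) => ((thin z.1 z.2).shift x, z.1.shift x) :=
  ((measurable_shift x).comp measurable_thin).prodMk ((measurable_shift x).comp measurable_fst)

theorem IsHardCoreThinning.isHardCoreMarking {Ω₀ Ω : Type*} [MeasurableSpace Ω₀]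
    [MeasurableSpace Ω] {P₀ : Measure Ω₀} {Φ : Ω₀ → Config d} {P : Measure Ω} {S : Ω → Ω₀}
    {Ψ : Ω → Config d} (hΦ : Measurable Φ) (hΨ : IsHardCoreThinning P₀ Φ P S Ψ) :
    IsHardCoreMarking (P₀.map Φ) (P.map fun ω => (Φ (S ω), marks (Ψ ω) (Φ (S ω)))) ∧
      ∀ w : Grain d → ℝ≥0∞, Measurable w →
        ∫⁻ z, ∫⁻ K, w K ∂(thin z.1 z.2).toMeasure
          ∂(P.map fun ω => (Φ (S ω), marks (Ψ ω) (Φ (S ω)))) =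
        ∫⁻ ω, ∫⁻ K, w K ∂(Ψ ω).toMeasure ∂P := by
  have hΦS : Measurable fun ω => Φ (S ω) := hΦ.comp hΨ.measurePreserving.measurable
  have hm : Measurable fun ω => (Φ (S ω), marks (Ψ ω) (Φ (S ω))) :=
    hΦS.prodMk (measurable_marks.comp (hΨ.measurable.prodMk hΦS))
  have hth : ∀ ω, thin (Φ (S ω)) (marks (Ψ ω) (Φ (S ω))) = Ψ ω := fun ω =>
    thin_marks (hΨ.subset ω)
  refine ⟨⟨?_, fun x => ?_, ?_⟩, fun w hw => ?_⟩
  · rw [Measure.map_map measurable_fst hm, ← hΨ.measurePreserving.map_eq,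
      Measure.map_map hΦ hΨ.measurePreserving.measurable]
    rfl
  · rw [Measure.map_map (measurable_shift_thin x) hm,
      Measure.map_map (measurable_thin.prodMk measurable_fst) hm]
    simp only [Function.comp_def, hth]
    exact hΨ.stationary x
  · have hset : MeasurableSet {z : Config d × (ℕ → Bool) | (thin z.1 z.2).IsHardCore} :=
      measurable_thin measurableSet_isHardCore
    rw [ae_map_iff hm.aemeasurable hset]
    simp only [hth]
    exact hΨ.hardCore
  · rw [lintegral_map _ hm]
    · simp only [hth]
    · exact measurable_lintegral_toMeasure measurable_thin (hw.comp measurable_snd)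

theorem shift_zero (φ : Config d) : φ.shift 0 = φ := by
  have h0 : ∀ K : Grain d, translate 0 K = K := fun K => by
    ext y; simp [coe_translate]
  refine Subtype.ext ?_
  change translate 0 '' φ.grains = φ.grains
  simp [h0]

/-- The shifted configuration with the marks of its grains. -/
noncomputable def shiftMarked (x : EuclideanSpace ℝ (Fin d)) (z : Config d × (ℕ → Bool)) :
    Config d × (ℕ → Bool) :=
  (z.1.shift x, marks ((thin z.1 z.2).shift x) (z.1.shift x))

theorem shift_subset_shift {ψ φ : Config d} (h : ψ.grains ⊆ φ.grains)
    (x : EuclideanSpace ℝ (Fin d)) : (ψ.shift x).grains ⊆ (φ.shift x).grains :=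
  image_mono h

theorem thin_subset (φ : Config d) (η : ℕ → Bool) : (thin φ η).grains ⊆ φ.grains :=
  fun _ hK => hK.1

theorem measurable_shiftMarked (x : EuclideanSpace ℝ (Fin d)) :
    Measurable (shiftMarked (d := d) x) :=
  ((measurable_shift x).comp measurable_fst).prodMk
    (measurable_marks.comp (measurable_shift_thin x))

/-- Stationarity in terms of marks. -/
theorem map_shift_thin_eq_iff {ρ : Measure (Config d × (ℕ → Bool))}
    {x : EuclideanSpace ℝ (Fin d)} :
    ρ.map (fun z => ((thin z.1 z.2).shift x, z.1.shift x)) =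
      ρ.map (fun z => (thin z.1 z.2, z.1)) ↔
    ρ.map (shiftMarked x) = ρ.map (shiftMarked 0) := by
  have hm1 : Measurable fun p : Config d × Config d => (p.2, marks p.1 p.2) :=
    measurable_snd.prodMk measurable_marks
  have hm2 : Measurable fun z : Config d × (ℕ → Bool) => (thin z.1 z.2, z.1) :=
    measurable_thin.prodMk measurable_fst
  -- The map `shiftMarked 0` is not the identity: it resets to `false` the marks at indices carried
  -- by no grain, on which stationarity imposes nothing.
  have h0 : (fun z : Config d × (ℕ → Bool) => (thin z.1 z.2, z.1)) =
      fun z => ((thin z.1 z.2).shift 0, z.1.shift 0) := by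
    simp only [shift_zero]
  constructor
  · intro h
    have h' := congrArg (Measure.map fun p : Config d × Config d => (p.2, marks p.1 p.2)) h
    rw [h0, Measure.map_map hm1 (measurable_shift_thin x),
      Measure.map_map hm1 (measurable_shift_thin 0)] at h'
    exact h'
  · intro h
    have h' := congrArg (Measure.map fun z : Config d × (ℕ → Bool) => (thin z.1 z.2, z.1)) h
    rw [Measure.map_map hm2 (measurable_shiftMarked x),
      Measure.map_map hm2 (measurable_shiftMarked 0)] at h'
    have hth : ∀ (y : EuclideanSpace ℝ (Fin d)),
        ((fun z : Config d × (ℕ → Bool) => (thin z.1 z.2, z.1)) ∘ shiftMarked y) =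
          fun z => ((thin z.1 z.2).shift y, z.1.shift y) := fun y => by
      ext1 z
      simp only [Function.comp, shiftMarked]
      rw [thin_marks (shift_subset_shift (thin_subset _ _) y)]
    rw [hth, hth] at h'
    rw [h', ← h0]

/-- The configurations in which the grains with indices `s` receive, after the shift by `x`, the
indices in `F`. -/
def reindexing (x : EuclideanSpace ℝ (Fin d)) (F : Finset ℕ) (s : F → ℕ) : Set (Config d) :=
  {φ | ∀ i : F, ∃ K ∈ φ.grains, (φ, K) ∈ {z : Config d × Grain d |
    index z.1 z.2 = s i ∧ index (z.1.shift x) (translate x z.2) = i}}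

theorem measurableSet_reindexing (x : EuclideanSpace ℝ (Fin d)) (F : Finset ℕ) (s : F → ℕ) :
    MeasurableSet (reindexing x F s) := by
  rw [reindexing, ofPred_forall]
  refine MeasurableSet.iInter fun i => measurableSet_exists_mem_grains
    (Ψ := fun φ : Config d => φ) measurable_id ((measurableSet_index_eq (s i)).inter ?_)
  exact (measurable_index.comp (((measurable_shift x).comp measurable_fst).prodMk
    ((translate_isometry x).continuous.measurable.comp measurable_snd)))
    (measurableSet_singleton (i : ℕ))

/-- Here `s` lists the old indices of the grains whose new indices are in `F`. Once `s` is fixed,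
the condition splits into one on the configuration and one on finitely many old marks; there are
countably many `s`. -/
theorem shiftMarked_preimage (x : EuclideanSpace ℝ (Fin d)) (A : Set (Config d))
    (F : Finset ℕ) : shiftMarked x ⁻¹' (A ×ˢ trueOn F) =
      ⋃ s : F → ℕ, (Config.shift x ⁻¹' A ∩ reindexing x F s) ×ˢ trueOn (Finset.univ.image s) := by
  ext ⟨φ, η⟩
  simp only [mem_preimage, shiftMarked, mem_prod, trueOn, mem_ofPred_eq, marks_eq_true,
    mem_shift, mem_iUnion, mem_inter_iff, reindexing, mem_thin]
  constructor
  · rintro ⟨hA, hF⟩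
    have hF' : ∀ i : F, ∃ K ∈ φ.grains, η (index φ K) = true ∧
        index (φ.shift x) (translate x K) = i := fun i => by
      obtain ⟨_, ⟨K, ⟨hK, hη⟩, rfl⟩, hi⟩ := hF i i.2
      exact ⟨K, hK, hη, hi⟩
    choose K hK hη hi using hF'
    refine ⟨fun i => index φ (K i), ⟨hA, fun i => ⟨K i, hK i, rfl, hi i⟩⟩, ?_⟩
    intro n hn
    obtain ⟨i, _, rfl⟩ := Finset.mem_image.1 hn
    exact hη i
  · rintro ⟨s, ⟨hA, hs⟩, hη⟩
    refine ⟨hA, fun i hi => ?_⟩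
    obtain ⟨K, hK, h1, h2⟩ := hs ⟨i, hi⟩
    refine ⟨_, ⟨K, ⟨hK, ?_⟩, rfl⟩, h2⟩
    rw [h1]
    exact hη _ (Finset.mem_image_of_mem _ (Finset.mem_univ _))

/-- The new index determines the grain, by injectivity of the numbering after the shift, and hence
its old index. -/
theorem pairwise_disjoint_reindexing (x : EuclideanSpace ℝ (Fin d)) (F : Finset ℕ) :
    Pairwise (Function.onFun Disjoint (reindexing x F)) := by
  intro s t hst
  refine disjoint_left.2 fun φ hs ht => hst (funext fun i => ?_)
  obtain ⟨K, hK, h1, h2⟩ := hs i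
  obtain ⟨L, hL, h3, h4⟩ := ht i
  have := index_injOn (φ.shift x) ⟨K, hK, rfl⟩ ⟨L, hL, rfl⟩ (h2.trans h4.symm)
  rw [(translate_isometry x).injective this] at h1
  exact h1.symm.trans h3

/-- The sets `trueOn F` form a π-system, since intersections correspond to unions of the index sets,
and the singletons `F = {n}` already generate the product `σ`-algebra. -/
theorem ext_of_prod_trueOn {X : Type*} [MeasurableSpace X] {ρ ρ' : Measure (X × (ℕ → Bool))}
    [IsFiniteMeasure ρ] (h : ∀ A, MeasurableSet A → ∀ F, ρ (A ×ˢ trueOn F) = ρ' (A ×ˢ trueOn F)) :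
    ρ = ρ' := by
  have huniv : trueOn ∅ = univ := by simp [trueOn]
  have hpi : MeasurableSpace.generateFrom (range trueOn) = MeasurableSpace.pi := by
    refine le_antisymm (MeasurableSpace.generateFrom_le ?_) ?_
    · rintro _ ⟨F, rfl⟩
      exact measurableSet_trueOn F
    · refine iSup_le fun n => ?_
      rw [← measurable_iff_comap_le]
      refine @measurable_to_bool _ (MeasurableSpace.generateFrom (range trueOn)) _ ?_
      refine MeasurableSpace.measurableSet_generateFrom ⟨{n}, ?_⟩
      ext η
      simp [trueOn]
  have hgen : (Prod.instMeasurableSpace : MeasurableSpace (X × (ℕ → Bool))) =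
      MeasurableSpace.generateFrom
        (image2 (· ×ˢ ·) {A : Set X | MeasurableSet A} (range trueOn)) := by
    rw [← generateFrom_eq_prod (MeasurableSpace.generateFrom_measurableSet) hpi
      isCountablySpanning_measurableSet ⟨fun _ => univ, fun _ => ⟨∅, huniv⟩, iUnion_const _⟩]
  refine ext_of_generate_finite _ hgen (MeasurableSpace.isPiSystem_measurableSet.prod ?_) ?_ ?_
  · rintro _ ⟨F, rfl⟩ _ ⟨G, rfl⟩ _
    refine ⟨F ∪ G, ?_⟩
    ext η
    simp [trueOn, or_imp, forall_and]
  · rintro _ ⟨A, hA, _, ⟨F, rfl⟩, rfl⟩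
    exact h A hA F
  · rw [← univ_prod_univ, ← huniv]
    exact h univ MeasurableSet.univ ∅

/-- Limits of hard-core markings are hard-core markings. -/
theorem IsHardCoreMarking.of_cylinderTendsto {κ : Type*} {l : Filter κ} [l.NeBot]
    {μ : Measure (Config d)} [IsFiniteMeasure μ] {ρ : κ → Measure (Config d × (ℕ → Bool))}
    {ρ' : Measure (Config d × (ℕ → Bool))} [IsFiniteMeasure ρ']
    (hρ : ∀ k, IsHardCoreMarking μ (ρ k)) (h : CylinderTendsto l ρ ρ')
    (hρ' : ρ'.map Prod.fst = μ) : IsHardCoreMarking μ ρ' := by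
  refine ⟨hρ', fun x => map_shift_thin_eq_iff.2 ?_, ?_⟩
  · have hlim : ∀ y A, MeasurableSet A → ∀ F, Tendsto
        (fun k => (ρ k).map (shiftMarked y) (A ×ˢ trueOn F)) l
        (𝓝 (ρ'.map (shiftMarked y) (A ×ˢ trueOn F))) := by
      intro y A hA F
      have hm := hA.prod (measurableSet_trueOn F)
      simp only [Measure.map_apply (measurable_shiftMarked y) hm, shiftMarked_preimage]
      exact h.measure_iUnion (fun k => (hρ k).map_fst)
        (fun s => (measurable_shift y hA).inter (measurableSet_reindexing y F s))
        (fun s t hst => (pairwise_disjoint_reindexing y F hst).mono inter_subset_right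
          inter_subset_right) _
    refine ext_of_prod_trueOn fun A hA F => tendsto_nhds_unique (hlim x A hA F) ?_
    refine (hlim 0 A hA F).congr fun k => ?_
    rw [map_shift_thin_eq_iff.1 ((hρ k).stationary x)]
  -- Sorting by the indices of an overlapping pair writes the violation of the hard-core condition
  -- as a countable union of product sets. Each is null for every `ρ k`, hence null in the limit.
  · let D : ℕ → ℕ → Set (Config d) := fun i j => {φ | ∃ K ∈ φ.grains, ∃ L ∈ φ.grains,
      (φ, K, L) ∈ {w : Config d × Grain d × Grain d |
        w.2 ∈ overlapping d ∧ index w.1 w.2.1 = i ∧ index w.1 w.2.2 = j}}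
    have hDm : ∀ i j, MeasurableSet (D i j) := fun i j =>
      measurableSet_exists_pair (Ψ := fun φ : Config d => φ) measurable_id
        ((measurable_snd measurableSet_overlapping).inter
          (((measurable_index.comp (measurable_fst.prodMk (measurable_fst.comp measurable_snd)))
            (measurableSet_singleton i)).inter
          ((measurable_index.comp (measurable_fst.prodMk (measurable_snd.comp measurable_snd)))
            (measurableSet_singleton j))))
    have hiff : ∀ z : Config d × (ℕ → Bool), ¬ (thin z.1 z.2).IsHardCore ↔
        ∃ i j, z ∈ D i j ×ˢ trueOn {i, j} := by
      intro z
      rw [isHardCore_iff, not_not]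
      simp only [mem_thin, mem_prod, D, mem_ofPred_eq, trueOn, Finset.mem_insert,
        Finset.mem_singleton, forall_eq_or_imp, forall_eq]
      constructor
      · rintro ⟨K, ⟨hK, hK'⟩, L, ⟨hL, hL'⟩, ho⟩
        exact ⟨_, _, ⟨K, hK, L, hL, ho, rfl, rfl⟩, hK', hL'⟩
      · rintro ⟨i, j, ⟨K, hK, L, hL, ho, rfl, rfl⟩, hK', hL'⟩
        exact ⟨K, ⟨hK, hK'⟩, L, ⟨hL, hL'⟩, ho⟩
    have hnull : ∀ i j, ρ' (D i j ×ˢ trueOn {i, j}) = 0 := fun i j => by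
      refine tendsto_nhds_unique (h _ (hDm i j) {i, j}) ?_
      refine tendsto_const_nhds.congr fun k => ?_
      exact (measure_mono_null (fun z hz => (hiff z).2 ⟨i, j, hz⟩) (hρ k).hardCore).symm
    have hae : ∀ᵐ z ∂ρ', ∀ i j, z ∉ D i j ×ˢ trueOn {i, j} :=
      ae_all_iff.2 fun i => ae_all_iff.2 fun j => measure_eq_zero_iff_ae_notMem.1 (hnull i j)
    filter_upwards [hae] with z hz
    by_contra hc
    obtain ⟨i, j, hij⟩ := (hiff z).1 hc
    exact hz i j hij

end Markings

/-! ### Passing between markings and thinnings. -/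

section Thinnings

variable {Ω₀ Ω : Type*} [MeasurableSpace Ω₀] [MeasurableSpace Ω] {P₀ : Measure Ω₀}
  {Φ : Ω₀ → Config d} {P : Measure Ω} {S : Ω → Ω₀} {Ψ : Ω → Config d}

theorem IsHardCoreThinning.intensity_le (hΦ : Measurable Φ)
    (hΨ : IsHardCoreThinning P₀ Φ P S Ψ) : intensity P Ψ ≤ intensity P₀ Φ := by
  have hm : Measurable fun ω => ∑' K : (Φ ω).grains,
      {L : Grain d | centre L ∈ unitCube d}.indicator (1 : Grain d → ℝ≥0∞) (K : Grain d) := by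
    have hf : Measurable ({L : Grain d | centre L ∈ unitCube d}.indicator
        (1 : Grain d → ℝ≥0∞)) := measurable_one.indicator measurableSet_centre_mem
    simp only [← lintegral_toMeasure _ hf]
    exact measurable_lintegral_toMeasure hΦ (hf.comp measurable_snd)
  rw [intensity, intensity, ← hΨ.measurePreserving.map_eq,
    lintegral_map hm hΨ.measurePreserving.measurable]
  exact lintegral_mono fun ω => ENNReal.tsum_mono_subtype _ (hΨ.subset ω)

/-- The configuration without grains. -/
def emptyConfig (d : ℕ) : Config d := ⟨∅, fun B _ => by simp⟩

theorem shift_emptyConfig (x : EuclideanSpace ℝ (Fin d)) :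
    (emptyConfig d).shift x = emptyConfig d :=
  Subtype.ext (image_empty _)

/-- This makes the supremum one over a nonempty set, so that a maximizing sequence exists. -/
theorem isHardCoreThinning_empty [IsProbabilityMeasure P₀]
    (hΦ : IsStationaryParticleProcess P₀ Φ) :
    IsHardCoreThinning P₀ Φ P₀ id fun _ => emptyConfig d where
  isProbabilityMeasure := inferInstance
  measurable := measurable_const
  measurePreserving := MeasurePreserving.id P₀
  subset _ := empty_subset _
  stationary x := by
    have hm : Measurable fun φ : Config d => (emptyConfig d, φ) := measurable_prodMk_left
    have h := congrArg (Measure.map fun φ : Config d => (emptyConfig d, φ)) (hΦ.stationary x)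
    have hs : Measurable fun ω => (Φ ω).shift x := (measurable_shift x).comp hΦ.measurable
    rw [Measure.map_map hm hs,
      Measure.map_map hm hΦ.measurable] at h
    simp only [shift_emptyConfig]
    exact h
  hardCore := Eventually.of_forall fun _ _ hK => absurd hK (notMem_empty _)

/-- A marking which is a measurable function of the process and an independent uniform variable
gives a thinning. -/
theorem IsHardCoreMarking.isHardCoreThinning [IsProbabilityMeasure P₀] (hΦ : Measurable Φ)
    {ξ : Config d × ℝ → ℕ → Bool} (hξ : Measurable ξ)
    (h : IsHardCoreMarking (P₀.map Φ)
      (((P₀.map Φ).prod (volume.restrict (Ico (0 : ℝ) 1))).map fun z => (z.1, ξ z))) :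
    IsHardCoreThinning P₀ Φ (P₀.prod (volume.restrict (Ico (0 : ℝ) 1))) Prod.fst
        (fun ω => thin (Φ ω.1) (ξ (Φ ω.1, ω.2))) ∧
      ∀ w : Grain d → ℝ≥0∞, Measurable w →
        ∫⁻ z, ∫⁻ K, w K ∂(thin z.1 z.2).toMeasure
          ∂(((P₀.map Φ).prod (volume.restrict (Ico (0 : ℝ) 1))).map fun z => (z.1, ξ z)) =
        ∫⁻ ω, ∫⁻ K, w K ∂(thin (Φ ω.1) (ξ (Φ ω.1, ω.2))).toMeasure
          ∂(P₀.prod (volume.restrict (Ico (0 : ℝ) 1))) := by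
  have hU : IsProbabilityMeasure (volume.restrict (Ico (0 : ℝ) 1)) := ⟨by simp⟩
  have hΦ1 : Measurable fun ω : Ω₀ × ℝ => Φ ω.1 := hΦ.comp measurable_fst
  have hξ1 : Measurable fun z : Config d × ℝ => (z.1, ξ z) := measurable_fst.prodMk hξ
  have hm : Measurable fun ω : Ω₀ × ℝ => (Φ ω.1, ξ (Φ ω.1, ω.2)) :=
    hΦ1.prodMk (hξ.comp (hΦ1.prodMk measurable_snd))
  -- The marks depend on the base point only through `Φ`, so the construction over the law of `Φ`
  -- lifts to `Ω₀ × ℝ`.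
  have hmap : ((P₀.map Φ).prod (volume.restrict (Ico (0 : ℝ) 1))).map (fun z => (z.1, ξ z)) =
      (P₀.prod (volume.restrict (Ico (0 : ℝ) 1))).map
        fun ω => (Φ ω.1, ξ (Φ ω.1, ω.2)) := by
    have h1 := Measure.map_prod_map P₀ (volume.restrict (Ico (0 : ℝ) 1)) hΦ measurable_id
    rw [Measure.map_id] at h1
    rw [h1, Measure.map_map hξ1 (hΦ.prodMap measurable_id)]
    rfl
  rw [hmap] at h ⊢
  refine ⟨⟨inferInstance, measurable_thin.comp hm, measurePreserving_fst, fun ω =>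
    thin_subset _ _, fun x => ?_, ?_⟩, fun w hw => ?_⟩
  · have hx := h.stationary x
    rw [Measure.map_map (measurable_shift_thin x) hm,
      Measure.map_map (measurable_thin.prodMk measurable_fst) hm] at hx
    exact hx
  · exact ae_of_ae_map hm.aemeasurable h.hardCore
  · exact lintegral_map (measurable_lintegral_toMeasure measurable_thin
      (hw.comp measurable_snd)) hm

end Thinnings

end HardCore

/-! ### Existence of an optimal thinning. -/

theorem theorem1 {d : ℕ} {Ω₀ : Type u} [MeasurableSpace Ω₀] (P₀ : Measure Ω₀)
    [IsProbabilityMeasure P₀] (Φ : Ω₀ → HardCore.Config d)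
    (hΦ : HardCore.IsStationaryParticleProcess P₀ Φ)
    (hγ_ne : HardCore.intensity P₀ Φ ≠ 0) (hγ_fin : HardCore.intensity P₀ Φ ≠ ∞)
    (h : HardCore.Grain d → ℝ≥0) (h_meas : Measurable h)
    (h_inv : ∀ x K, h (HardCore.translate x K) = h K)
    (h_fin : HardCore.hIntensity P₀ Φ h ≠ ∞)
    (h_disc : HardCore.typicalGrain P₀ Φ {K | ¬ ContinuousAt h K} = 0) :
    ∃ (Ω : Type u) (_ : MeasurableSpace Ω) (P : Measure Ω) (S : Ω → Ω₀)
      (Ψ : Ω → HardCore.Config d),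
      HardCore.IsHardCoreThinning P₀ Φ P S Ψ ∧
        HardCore.hIntensity P Ψ h = HardCore.maxHIntensity P₀ Φ h := by
  open HardCore Filter Topology in
  have hΦm := hΦ.measurable
  have hw := measurable_cubeWeight h_meas
  have hμ : IsProbabilityMeasure (P₀.map Φ) := Measure.isProbabilityMeasure_map hΦm.aemeasurable
  have hU : IsProbabilityMeasure (volume.restrict (Ico (0 : ℝ) 1)) := ⟨by simp⟩
  obtain ⟨v, -, hv, hvmem⟩ := exists_seq_tendsto_sSup (S := {v | ∃ (Ω : Type u)
    (_ : MeasurableSpace Ω) (P : Measure Ω) (S : Ω → Ω₀) (Ψ : Ω → Config d),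
    IsHardCoreThinning P₀ Φ P S Ψ ∧ v = hIntensity P Ψ h})
    ⟨_, Ω₀, _, P₀, id, _, isHardCoreThinning_empty hΦ, rfl⟩ (OrderTop.bddAbove _)
  have hmarking : ∀ n, ∃ ρ, IsHardCoreMarking (P₀.map Φ) ρ ∧
      ∫⁻ z, ∫⁻ K, cubeWeight h K ∂(thin z.1 z.2).toMeasure ∂ρ = v n := fun n => by
    obtain ⟨Ω, _, P, S, Ψ, hΨ, hvn⟩ := hvmem n
    obtain ⟨h1, h2⟩ := hΨ.isHardCoreMarking hΦm
    refine ⟨_, h1, ?_⟩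
    rw [h2 _ hw, hvn, hIntensity_eq_lintegral hΨ.measurable
      (ne_top_of_le_ne_top hγ_fin (hΨ.intensity_le hΦm)) h_meas h_inv]
  choose ρ hρ hρv using hmarking
  -- The hyperfilter is an ultrafilter finer than `atTop`, so the values `v n` still tend to the
  -- supremum along it.
  obtain ⟨ξ, hξ, hlim⟩ := exists_cylinderTendsto (P₀.map Φ) (hyperfilter ℕ) ρ
    fun n => (hρ n).map_fst
  have hξ1 : Measurable fun z : Config d × ℝ => (z.1, ξ z) := measurable_fst.prodMk hξ
  set ρ' := ((P₀.map Φ).prod (volume.restrict (Ico (0 : ℝ) 1))).map fun z => (z.1, ξ z) with hρ'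
  have hprob : IsProbabilityMeasure ρ' := Measure.isProbabilityMeasure_map hξ1.aemeasurable
  have hfst : ρ'.map Prod.fst = P₀.map Φ := by
    rw [hρ', Measure.map_map measurable_fst hξ1]
    exact measurePreserving_fst.map_eq
  obtain ⟨hthin, hint⟩ := (IsHardCoreMarking.of_cylinderTendsto hρ hlim hfst).isHardCoreThinning
    hΦm hξ
  refine ⟨Ω₀ × ℝ, inferInstance, _, Prod.fst, _, hthin, ?_⟩
  rw [hIntensity_eq_lintegral hthin.measurable
    (ne_top_of_le_ne_top hγ_fin (hthin.intensity_le hΦm)) h_meas h_inv, ← hint _ hw]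
  -- This sum is `γ_h(Φ)`; its finiteness prevents any loss of `h`-intensity in the limit.
  have hsum : ∑' n, ∫⁻ φ, indexedWeight (cubeWeight h) n φ ∂(P₀.map Φ) ≠ ∞ := by
    rw [← lintegral_tsum fun n => (measurable_indexedWeight hw n).aemeasurable]
    simp only [tsum_indexedWeight hw]
    rw [lintegral_map (measurable_lintegral_toMeasure (Ψ := fun φ : Config d => φ) measurable_id
      (f := fun _ => cubeWeight h) (hw.comp measurable_snd)) hΦm]
    rwa [hIntensity_eq_lintegral hΦm hγ_fin h_meas h_inv] at h_fin
  have hconv := hlim.lintegral_tsum (fun n => (hρ n).map_fst)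
    (measurable_indexedWeight hw) (fun n => {n}) hsum
  simp only [← lintegral_thin_eq_tsum hw, hρv] at hconv
  exact tendsto_nhds_unique hconv (hv.mono_left Nat.hyperfilter_le_atTop)
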